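/- Conventions. A function $F:X\to Y$ between metric spaces is a quasi-isometry if there are $\lambda\ge 1$ and $\epsilon\ge 0$ such that $\lambda^{-1}|x-x'|-\epsilon\le |F(x)-F(x')|\le\lambda|x-x'|+\epsilon$ for all $x,x'\in X$, and every $y\in Y$ satisfies $|F(x)-y|\le\epsilon$ for some $x\in X$. A Borel measure $\mu$ on a metric space $X$ has bounded geometry if there is $r_0>0$ such that $0<\inf_{x\in X}\mu(B(x,r))$ and $\sup_{x\in X}\mu(B(x,r))<+\infty$ for every $r\ge r_0$, where $B(x,r)$ is the open ball. A Young function is a convex even function $\phi:\mathbb{R}\to[0,+\infty)$ with $\phi(t)=0$ if and only if $t=0$. For $k\ge 0$ and $s>0$ let $X_s^{k+1}$ be the set of tuples in $X^{k+1}$ of diameter at most $s$. Let $AS_\phi^k(X)$ be the space of classes, modulo equality $\mu^{k+1}$-almost everywhere, of measurable functions $u:X^{k+1}\to\mathbb{R}$ such that $$\|u\|_{\phi,s}=\inf\Bigl\{\alpha>0:\int_{X_s^{k+1}}\phi\bigl(u/\alpha\bigr)\,d\mu^{k+1}\le 1\Bigr\}<+\infty\quad\text{for every }s>0,$$ with the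 topology induced by the semi-norms $\|\cdot\|_{\phi,s}$, $s>0$. Let $d_k:AS_\phi^k(X)\to AS_\phi^{k+1}(X)$ be given by $d_ku(x_0,\dots,x_{k+1})=\sum_{i=0}^{k+1}(-1)^iu(x_0,\dots,\hat x_i,\dots,x_{k+1})$, and put $\operatorname{Im}d_{-1}=0$. The asymptotic Orlicz cohomology and its reduced version are $$L^\phi H^k_{AS}(X)=\operatorname{Ker}d_k/\operatorname{Im}d_{k-1},\qquad L^\phi\overline{H}^k_{AS}(X)=\operatorname{Ker}d_k/\overline{\operatorname{Im}d_{k-1}},$$ with the quotient topologies. Theorem. Let $(X,\mu)$ and $(Y,\nu)$ be two metric spaces equipped with Borel measures of bounded geometry, and let $\phi$ be a Young function. If there exists a quasi-isometry $F:X\to Y$, then for every $k\ge 0$ the spaces $L^\phi H^k_{AS}(X)$ and $L^\phi H^k_{AS}(Y)$ are isomorphic as topological vector spaces, and $L^\phi\overline{H}^k_{AS}(X)$ and $L^\phi\overline{H}^k_{AS}(Y)$ are Fréchet spaces and are isomorphic as Fréchet spaces (that is, by a linear homeomorphism). -/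

import Mathlib

open MeasureTheory Set
open scoped ENNReal Topology

noncomputable section

/-! ### Quasi-isometries, bounded geometry, Young functions -/

/-- `F : X → Y` is a quasi-isometry. -/
def IsQuasiIsometry {X Y : Type*} [MetricSpace X] [MetricSpace Y] (F : X → Y) : Prop :=
  ∃ L ε : ℝ, 1 ≤ L ∧ 0 ≤ ε ∧
    (∀ x x' : X, L⁻¹ * dist x x' - ε ≤ dist (F x) (F x') ∧
      dist (F x) (F x') ≤ L * dist x x' + ε) ∧
    ∀ y : Y, ∃ x : X, dist (F x) y ≤ ε

/-- The measure `μ` has bounded geometry: from some radius on, the measures of open balls of a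
given radius are bounded away from `0` and from `∞`, uniformly in the centre. -/
class BoundedGeometry {X : Type*} [MetricSpace X] [MeasurableSpace X] (μ : Measure X) :
    Prop where
  exists_radius : ∃ r₀ : ℝ, 0 < r₀ ∧ ∀ r : ℝ, r₀ ≤ r →
    0 < (⨅ x : X, μ (Metric.ball x r)) ∧ (⨆ x : X, μ (Metric.ball x r)) < ∞

/-- Young functions: non-negative, convex, even functions on `ℝ` that vanish exactly at `0`. -/
structure YoungFunction where
  toFun : ℝ → ℝ
  nonneg' : ∀ t, 0 ≤ toFun t
  convex' : ConvexOn ℝ univ toFun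
  even' : ∀ t, toFun (-t) = toFun t
  eq_zero_iff' : ∀ t, toFun t = 0 ↔ t = 0

instance : CoeFun YoungFunction fun _ => ℝ → ℝ := ⟨YoungFunction.toFun⟩

namespace YoungFunction

variable (φ : YoungFunction)

theorem map_zero : φ 0 = 0 := (φ.eq_zero_iff' 0).2 rfl

theorem map_smul_le {c : ℝ} (h0 : 0 ≤ c) (h1 : c ≤ 1) (t : ℝ) : φ (c * t) ≤ c * φ t := by
  have := φ.convex'.2 (mem_univ t) (mem_univ 0) h0 (sub_nonneg.2 h1) (by ring)
  simpa [φ.map_zero] using this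

theorem map_abs (t : ℝ) : φ |t| = φ t := by
  rcases abs_choice t with h | h <;> rw [h]
  exact φ.even' t

theorem map_mul_le {c : ℝ} (hc : |c| ≤ 1) (t : ℝ) : φ (c * t) ≤ φ t := by
  rw [← φ.map_abs, abs_mul, ← φ.map_abs t]
  refine (φ.map_smul_le (abs_nonneg c) hc _).trans ?_
  exact mul_le_of_le_one_left (φ.nonneg' _) hc

theorem continuous : Continuous φ :=
  continuousOn_univ.1 (φ.convex'.continuousOn isOpen_univ)

end YoungFunction

/-! ### Simplices and faces -/

/-- `X_s^{k+1}`: the `k`-simplices (`(k+1)`-tuples of points) of diameter at most `s`. -/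
def smallSimplices (X : Type*) [MetricSpace X] (k : ℕ) (s : ℝ) : Set (Fin (k + 1) → X) :=
  {Δ | Metric.diam (range Δ) ≤ s}

/-- The face `∂ᵢ Δ`, in which the `i`-th vertex is left out. -/
def face {X : Type*} {k : ℕ} (i : Fin (k + 2)) (Δ : Fin (k + 2) → X) : Fin (k + 1) → X :=
  fun j => Δ (i.succAbove j)

/-- The product measure `μ^{k+1}` on `X^{k+1}`. -/
abbrev simplexMeasure {X : Type*} [MeasurableSpace X] (μ : Measure X) (k : ℕ) :
    Measure (Fin (k + 1) → X) :=
  Measure.pi fun _ => μ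

/-- Classes of measurable functions `X^{k+1} → ℝ` modulo equality almost everywhere. -/
abbrev Cochain {X : Type*} [MeasurableSpace X] (μ : Measure X) (k : ℕ) : Type _ :=
  (Fin (k + 1) → X) →ₘ[simplexMeasure μ k] ℝ

section BoundedGeometryLemmas

variable {X : Type*} [MetricSpace X]

theorem dist_le_of_mem_smallSimplices {k : ℕ} {s : ℝ} {Δ : Fin (k + 1) → X}
    (h : Δ ∈ smallSimplices X k s) (i j : Fin (k + 1)) : dist (Δ i) (Δ j) ≤ s :=
  (Metric.dist_le_diam_of_mem (finite_range Δ).isBounded (mem_range_self i)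
    (mem_range_self j)).trans h

theorem face_mem_smallSimplices {k : ℕ} {s : ℝ} {Δ : Fin (k + 2) → X}
    (h : Δ ∈ smallSimplices X (k + 1) s) (i : Fin (k + 2)) :
    face i Δ ∈ smallSimplices X k s := by
  refine (Metric.diam_mono ?_ (finite_range Δ).isBounded).trans h
  rintro _ ⟨j, rfl⟩
  exact mem_range_self _

variable [MeasurableSpace X] (μ : Measure X) [BoundedGeometry μ]

theorem measure_ball_lt_top (x : X) (r : ℝ) : μ (Metric.ball x r) < ∞ := by
  obtain ⟨r₀, -, h⟩ := BoundedGeometry.exists_radius (μ := μ)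
  calc μ (Metric.ball x r) ≤ μ (Metric.ball x (max r r₀)) :=
        measure_mono (Metric.ball_subset_ball (le_max_left _ _))
    _ ≤ ⨆ x, μ (Metric.ball x (max r r₀)) := le_iSup (fun x => μ (Metric.ball x (max r r₀))) x
    _ < ∞ := (h _ (le_max_right _ _)).2

instance BoundedGeometry.sigmaFinite : SigmaFinite μ := by
  rcases isEmpty_or_nonempty X with h | ⟨⟨x⟩⟩
  · rw [Measure.eq_zero_of_isEmpty μ]; infer_instance
  · refine ⟨⟨⟨fun n => Metric.ball x n, fun _ => trivial, fun n => measure_ball_lt_top μ x n, ?_⟩⟩⟩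
    exact Metric.iUnion_ball_nat x

theorem quasiMeasurePreserving_face (k : ℕ) (i : Fin (k + 2)) :
    Measure.QuasiMeasurePreserving (face (X := X) i) (simplexMeasure μ (k + 1))
      (simplexMeasure μ k) := by
  have h := (measurePreserving_piFinSuccAbove (fun _ : Fin (k + 2) => μ) i).quasiMeasurePreserving
  exact Measure.quasiMeasurePreserving_snd.comp h

variable [BorelSpace X]

/-- A space with bounded geometry has a countable coarsely dense subset. -/
theorem exists_countable_net (μ : Measure X) [BoundedGeometry μ] :
    ∃ (N : Set X) (R : ℝ), N.Countable ∧ ∀ x, ∃ n ∈ N, dist x n < R := by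
  obtain ⟨r₀, hr₀, h⟩ := BoundedGeometry.exists_radius (μ := μ)
  obtain ⟨N, hN⟩ : ∃ N : Set X, Maximal (fun N : Set X => N.PairwiseDisjoint
      (fun x => Metric.ball x r₀)) N := by
    refine zorn_subset _ fun c hc hchain => ⟨⋃₀ c, ?_, fun s hs => subset_sUnion_of_mem hs⟩
    exact (pairwiseDisjoint_sUnion hchain.directedOn).2 hc
  refine ⟨N, 2 * r₀ + 1, ?_, fun x => ?_⟩
  · have hc := Measure.countable_meas_pos_of_disjoint_iUnion (μ := μ)
      (As := fun n : N => Metric.ball (n : X) r₀) (fun _ => Metric.isOpen_ball.measurableSet)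
      (fun a b hab => hN.prop a.2 b.2 (fun h => hab (Subtype.ext h)))
    have : {n : N | 0 < μ (Metric.ball (n : X) r₀)} = univ :=
      eq_univ_of_forall fun n => (h r₀ le_rfl).1.trans_le (iInf_le _ (n : X))
    rw [this] at hc
    exact countable_coe_iff.1 (countable_univ_iff.1 hc)
  · by_contra! hx
    have hins : (insert x N).PairwiseDisjoint (fun x => Metric.ball x r₀) := by
      refine hN.prop.insert fun n hn _ => Metric.ball_disjoint_ball ?_
      linarith [hx n hn]
    have hxN : x ∈ N := hN.le_of_ge hins (subset_insert _ _) (mem_insert _ _)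
    have := hx x hxN
    rw [dist_self] at this
    linarith

/-- Integrating out one vertex of a small simplex costs at most a constant factor. -/
theorem exists_lintegral_face_le (k : ℕ) (i : Fin (k + 2)) (s : ℝ) :
    ∃ C : ℝ, 1 ≤ C ∧ ∀ f : (Fin (k + 1) → X) → ℝ≥0∞, Measurable f →
      ∫⁻ Δ in smallSimplices X (k + 1) s, f (face i Δ) ∂(simplexMeasure μ (k + 1)) ≤
        ENNReal.ofReal C * ∫⁻ Δ in smallSimplices X k s, f Δ ∂(simplexMeasure μ k) := by
  obtain ⟨N, R, hNc, hN⟩ := exists_countable_net μ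
  obtain ⟨r₀, hr₀, h⟩ := BoundedGeometry.exists_radius (μ := μ)
  set r : ℝ := max r₀ (s + 2 * R) with hr
  set V : ℝ≥0∞ := ⨆ x, μ (Metric.ball x r) with hV
  have hVtop : V < ∞ := (h r (le_max_left _ _)).2
  refine ⟨max 1 V.toReal, le_max_left _ _, fun f hf => ?_⟩
  set S := toMeasurable (simplexMeasure μ k) (smallSimplices X k s) with hS
  have hSm : MeasurableSet S := measurableSet_toMeasurable _ _
  have := hNc.to_subtype
  let W : Set (X × (Fin (k + 1) → X)) :=
    ⋃ n : N, Metric.ball (n : X) (s + R) ×ˢ {Δ | Δ 0 ∈ Metric.ball (n : X) R}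
  have hWm : MeasurableSet W := by
    refine MeasurableSet.iUnion fun n => Metric.isOpen_ball.measurableSet.prod ?_
    exact (measurable_pi_apply 0) Metric.isOpen_ball.measurableSet
  have hslice : ∀ Δ : Fin (k + 1) → X, μ ((fun x => (x, Δ)) ⁻¹' W) ≤ V := fun Δ => by
    refine (measure_mono ?_).trans (le_iSup (fun x => μ (Metric.ball x r)) (Δ 0))
    intro x hx
    simp only [W, mem_preimage, mem_iUnion, mem_prod, Metric.mem_ball, mem_ofPred_eq] at hx
    obtain ⟨n, h1, h2⟩ := hx
    rw [Metric.mem_ball]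
    have := dist_triangle_right x (Δ 0) n
    exact lt_of_lt_of_le (by linarith) (le_max_right _ _)
  let E : Set (X × (Fin (k + 1) → X)) := W ∩ Prod.snd ⁻¹' S
  have hEm : MeasurableSet E := hWm.inter (measurable_snd hSm)
  let e := MeasurableEquiv.piFinSuccAbove (fun _ : Fin (k + 2) => X) i
  have he := measurePreserving_piFinSuccAbove (fun _ : Fin (k + 2) => μ) i
  have hsub : smallSimplices X (k + 1) s ⊆ e ⁻¹' E := by
    intro Δ hΔ
    refine ⟨?_, subset_toMeasurable _ _ (face_mem_smallSimplices hΔ i)⟩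
    obtain ⟨n, hn, hd⟩ := hN (Δ (i.succAbove 0))
    refine mem_iUnion.2 ⟨⟨n, hn⟩, ?_, hd⟩
    have h1 := dist_le_of_mem_smallSimplices hΔ i (i.succAbove 0)
    have h2 := dist_triangle (Δ i) (Δ (i.succAbove 0)) n
    exact lt_of_le_of_lt h2 (by linarith)
  calc ∫⁻ Δ in smallSimplices X (k + 1) s, f (face i Δ) ∂(simplexMeasure μ (k + 1))
      ≤ ∫⁻ Δ in e ⁻¹' E, f (face i Δ) ∂(simplexMeasure μ (k + 1)) := lintegral_mono_set hsub
    _ = ∫⁻ p in E, f p.2 ∂(μ.prod (simplexMeasure μ k)) :=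
        he.setLIntegral_comp_preimage hEm (hf.comp measurable_snd)
    _ = ∫⁻ p, E.indicator (fun p => f p.2) p ∂(μ.prod (simplexMeasure μ k)) :=
        (lintegral_indicator hEm _).symm
    _ = ∫⁻ Δ, ∫⁻ x, E.indicator (fun p => f p.2) (x, Δ) ∂μ ∂(simplexMeasure μ k) :=
        lintegral_prod_symm' _ ((hf.comp measurable_snd).indicator hEm)
    _ ≤ ∫⁻ Δ, S.indicator (fun Δ => V * f Δ) Δ ∂(simplexMeasure μ k) := by
        refine lintegral_mono fun Δ => ?_
        by_cases hΔ : Δ ∈ S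
        · have : ∀ x, E.indicator (fun p => f p.2) (x, Δ) =
              ((fun x => (x, Δ)) ⁻¹' W).indicator (fun _ => f Δ) x := fun x => by
            by_cases hx : (x, Δ) ∈ W
            · rw [indicator_of_mem (show (x, Δ) ∈ E from ⟨hx, hΔ⟩),
                indicator_of_mem (show x ∈ (fun x => (x, Δ)) ⁻¹' W from hx)]
            · rw [indicator_of_notMem (show (x, Δ) ∉ E from fun h => hx h.1),
                indicator_of_notMem (show x ∉ (fun x => (x, Δ)) ⁻¹' W from hx)]
          simp only [this, indicator_of_mem hΔ]
          rw [lintegral_indicator (measurable_prodMk_right hWm), setLIntegral_const, mul_comm]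
          exact mul_le_mul_left (hslice Δ) _
        · have : ∀ x, E.indicator (fun p => f p.2) (x, Δ) = 0 := fun x =>
            indicator_of_notMem (fun h => hΔ h.2) _
          simp [this]
    _ = V * ∫⁻ Δ in S, f Δ ∂(simplexMeasure μ k) := by
        rw [lintegral_indicator hSm, lintegral_const_mul _ hf]
    _ = V * ∫⁻ Δ in smallSimplices X k s, f Δ ∂(simplexMeasure μ k) := by
        rw [hS, Measure.restrict_toMeasurable_of_sFinite]
    _ ≤ _ := by
        gcongr
        exact (ENNReal.ofReal_toReal hVtop.ne).symm.le.trans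
          (ENNReal.ofReal_le_ofReal (le_max_right _ _))

end BoundedGeometryLemmas

/-! ### Orlicz spaces of Alexander-Spanier cochains -/

section Cochains

variable {X : Type*} [MetricSpace X] [MeasurableSpace X]

/-- The modular `ρ_{φ,s}(u) = ∫_{X_s^{k+1}} φ(u(Δ)) dΔ`. -/
def modular (φ : YoungFunction) (μ : Measure X) {k : ℕ} (s : ℝ) (u : Cochain μ k) : ℝ≥0∞ :=
  ∫⁻ Δ in smallSimplices X k s, ENNReal.ofReal (φ (u Δ)) ∂(simplexMeasure μ k)

variable (φ : YoungFunction) (μ : Measure X)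

theorem modular_congr {k : ℕ} (s : ℝ) (u : Cochain μ k) {f : (Fin (k + 1) → X) → ℝ}
    (h : u =ᵐ[simplexMeasure μ k] f) : modular φ μ s u =
      ∫⁻ Δ in smallSimplices X k s, ENNReal.ofReal (φ (f Δ)) ∂(simplexMeasure μ k) :=
  lintegral_congr_ae ((ae_restrict_of_ae h).mono fun Δ h => by simp only [h])

theorem modular_smul {k : ℕ} (s c : ℝ) (u : Cochain μ k) : modular φ μ s (c • u) =
      ∫⁻ Δ in smallSimplices X k s, ENNReal.ofReal (φ (c * u Δ)) ∂(simplexMeasure μ k) :=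
  modular_congr φ μ s _ (AEEqFun.coeFn_smul c u)

theorem modular_zero {k : ℕ} (s : ℝ) : modular φ μ s (0 : Cochain μ k) = 0 := by
  rw [modular_congr φ μ s _ AEEqFun.coeFn_zero]
  simp [φ.map_zero]

theorem modular_smul_le {k : ℕ} (s : ℝ) {c : ℝ} (hc : |c| ≤ 1) (u : Cochain μ k) :
    modular φ μ s (c • u) ≤ modular φ μ s u := by
  rw [modular_smul]
  exact lintegral_mono fun Δ => ENNReal.ofReal_le_ofReal (φ.map_mul_le hc _)

theorem modular_smul_le_mul {k : ℕ} (s : ℝ) {c : ℝ} (h0 : 0 ≤ c) (h1 : c ≤ 1)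
    (u : Cochain μ k) : modular φ μ s (c • u) ≤ ENNReal.ofReal c * modular φ μ s u := by
  rw [modular_smul, modular, ← lintegral_const_mul' _ _ ENNReal.ofReal_ne_top]
  refine lintegral_mono fun Δ => ?_
  rw [← ENNReal.ofReal_mul h0]
  exact ENNReal.ofReal_le_ofReal (φ.map_smul_le h0 h1 _)

theorem modular_convex_le {k : ℕ} (s : ℝ) {a b : ℝ} (ha : 0 ≤ a) (hb : 0 ≤ b) (hab : a + b = 1)
    (u v : Cochain μ k) : modular φ μ s (a • u + b • v) ≤
      ENNReal.ofReal a * modular φ μ s u + ENNReal.ofReal b * modular φ μ s v := by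
  have h : (a • u + b • v : Cochain μ k) =ᵐ[simplexMeasure μ k] fun Δ => a * u Δ + b * v Δ := by
    filter_upwards [AEEqFun.coeFn_add (a • u) (b • v), AEEqFun.coeFn_smul a u,
      AEEqFun.coeFn_smul b v] with Δ h1 h2 h3
    simp [h1, h2, h3]
  have hm : AEMeasurable (fun Δ => ENNReal.ofReal a * ENNReal.ofReal (φ (u Δ)))
      ((simplexMeasure μ k).restrict (smallSimplices X k s)) :=
    ((ENNReal.measurable_ofReal.comp
      (φ.continuous.measurable.comp u.measurable)).const_mul _).aemeasurable
  rw [modular_congr φ μ s _ h, modular, modular,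
    ← lintegral_const_mul' _ _ ENNReal.ofReal_ne_top,
    ← lintegral_const_mul' _ _ ENNReal.ofReal_ne_top, ← lintegral_add_left' hm]
  refine lintegral_mono fun Δ => ?_
  rw [← ENNReal.ofReal_mul ha, ← ENNReal.ofReal_mul hb,
    ← ENNReal.ofReal_add (mul_nonneg ha (φ.nonneg' _)) (mul_nonneg hb (φ.nonneg' _))]
  exact ENNReal.ofReal_le_ofReal (φ.convex'.2 (mem_univ _) (mem_univ _) ha hb hab)

/-- The space `AS_φ^k(X)`: classes `u` such that for every `s > 0` some `α > 0` satisfies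
`ρ_{φ,s}(u/α) ≤ 1`, that is, `‖u‖_{φ,s} < ∞`. -/
def ASSubmodule (k : ℕ) : Submodule ℝ (Cochain μ k) where
  carrier := {u | ∀ s : ℝ, 0 < s → ∃ α : ℝ, 0 < α ∧ modular φ μ s (α⁻¹ • u) ≤ 1}
  zero_mem' := fun s _ => ⟨1, one_pos, by rw [smul_zero, modular_zero]; exact zero_le_one⟩
  add_mem' := by
    intro u v hu hv s hs
    obtain ⟨α, hα, hu⟩ := hu s hs
    obtain ⟨β, hβ, hv⟩ := hv s hs
    refine ⟨α + β, by positivity, ?_⟩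
    have e : (α + β)⁻¹ • (u + v) =
        (α / (α + β)) • (α⁻¹ • u) + (β / (α + β)) • (β⁻¹ • v) := by
      rw [smul_smul, smul_smul, smul_add]
      congr 2 <;> field_simp
    have hab : α / (α + β) + β / (α + β) = 1 := by field_simp
    rw [e]
    refine (modular_convex_le φ μ s (by positivity) (by positivity) hab _ _).trans ?_
    calc _ ≤ ENNReal.ofReal (α / (α + β)) * 1 + ENNReal.ofReal (β / (α + β)) * 1 := by gcongr
      _ = 1 := by
        rw [mul_one, mul_one, ← ENNReal.ofReal_add (by positivity) (by positivity), hab,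
          ENNReal.ofReal_one]
  smul_mem' := by
    intro c u hu s hs
    obtain ⟨α, hα, hu⟩ := hu s hs
    refine ⟨α * (|c| + 1), by positivity, ?_⟩
    have e : (α * (|c| + 1))⁻¹ • (c • u) = (c / (|c| + 1)) • (α⁻¹ • u) := by
      rw [smul_smul, smul_smul]
      congr 1
      field_simp
    rw [e]
    refine (modular_smul_le φ μ s ?_ _).trans hu
    rw [abs_div, abs_of_pos (by positivity : 0 < |c| + 1), div_le_one (by positivity)]
    linarith

/-- The vector space `AS_φ^k(X)` of Alexander-Spanier `k`-cochains. -/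
def AS (k : ℕ) : Type _ := ASSubmodule φ μ k

instance (k : ℕ) : AddCommGroup (AS φ μ k) := inferInstanceAs (AddCommGroup (ASSubmodule φ μ k))

instance (k : ℕ) : Module ℝ (AS φ μ k) := inferInstanceAs (Module ℝ (ASSubmodule φ μ k))

/-- The class of functions underlying an element of `AS_φ^k(X)`. -/
def AS.toCochain (k : ℕ) : AS φ μ k →ₗ[ℝ] Cochain μ k := (ASSubmodule φ μ k).subtype

/-- The unit ball `{u | ρ_{φ,s}(u) ≤ 1}`. -/
def modularBall (k : ℕ) (s : ℝ) : Set (AS φ μ k) :=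
  {u | modular φ μ s (AS.toCochain φ μ k u) ≤ 1}

theorem modularBall_balanced (k : ℕ) (s : ℝ) : Balanced ℝ (modularBall φ μ k s) := by
  rintro c hc _ ⟨u, hu, rfl⟩
  show modular φ μ s (AS.toCochain φ μ k (c • u)) ≤ 1
  rw [map_smul]
  exact (modular_smul_le φ μ s hc _).trans hu

theorem modularBall_convex (k : ℕ) (s : ℝ) : Convex ℝ (modularBall φ μ k s) := by
  intro u hu v hv a b ha hb hab
  show modular φ μ s (AS.toCochain φ μ k (a • u + b • v)) ≤ 1
  rw [map_add, map_smul, map_smul]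
  refine (modular_convex_le φ μ s ha hb hab _ _).trans ?_
  have hu' : modular φ μ s (AS.toCochain φ μ k u) ≤ 1 := hu
  have hv' : modular φ μ s (AS.toCochain φ μ k v) ≤ 1 := hv
  calc _ ≤ ENNReal.ofReal a * 1 + ENNReal.ofReal b * 1 := by gcongr
    _ = 1 := by rw [mul_one, mul_one, ← ENNReal.ofReal_add ha hb, hab, ENNReal.ofReal_one]

theorem modularBall_absorbent (k : ℕ) {s : ℝ} (hs : 0 < s) :
    Absorbent ℝ (modularBall φ μ k s) := by
  intro u
  obtain ⟨α, hα, hu⟩ := u.2 s hs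
  refine Absorbs.of_norm ⟨α, fun c hc => ?_⟩
  have hc0 : c ≠ 0 := fun h => by
    rw [h, norm_zero] at hc
    linarith
  rw [singleton_subset_iff, mem_smul_set_iff_inv_smul_mem₀ hc0]
  show modular φ μ s (AS.toCochain φ μ k (c⁻¹ • u)) ≤ 1
  have e : AS.toCochain φ μ k (c⁻¹ • u) = (α / c) • (α⁻¹ • AS.toCochain φ μ k u) := by
    rw [map_smul, smul_smul]
    congr 1
    field_simp
  rw [e]
  refine (modular_smul_le φ μ s ?_ _).trans hu
  rw [abs_div, abs_of_pos hα, div_le_one (abs_pos.2 hc0)]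
  exact hc

/-- The Luxemburg semi-norm `‖u‖_{φ,s} = inf {α > 0 : ρ_{φ,s}(u/α) ≤ 1}`, which is the gauge of
the unit ball of the modular (see `luxemburg_apply`). -/
def luxemburg (k : ℕ) (s : Ioi (0 : ℝ)) : Seminorm ℝ (AS φ μ k) :=
  gaugeSeminorm (modularBall_balanced φ μ k s) (modularBall_convex φ μ k s)
    (modularBall_absorbent φ μ k s.2)

theorem luxemburg_apply (k : ℕ) (s : Ioi (0 : ℝ)) (u : AS φ μ k) :
    luxemburg φ μ k s u =
      sInf {α : ℝ | 0 < α ∧ modular φ μ (s : ℝ) (α⁻¹ • AS.toCochain φ μ k u) ≤ 1} := by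
  exact gauge_def'

/-- `AS_φ^k(X)` carries the topology induced by the semi-norms `‖·‖_{φ,s}`, `s > 0`. -/
instance (k : ℕ) : TopologicalSpace (AS φ μ k) :=
  SeminormFamily.moduleFilterBasis (luxemburg φ μ k) |>.topology

theorem withSeminorms_luxemburg (k : ℕ) : WithSeminorms (luxemburg φ μ k) := ⟨rfl⟩

instance (k : ℕ) : IsTopologicalAddGroup (AS φ μ k) :=
  (withSeminorms_luxemburg φ μ k).topologicalAddGroup

instance (k : ℕ) : ContinuousSMul ℝ (AS φ μ k) :=
  (withSeminorms_luxemburg φ μ k).continuousSMul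

end Cochains

/-! ### The coboundary operator and cohomology -/

section Cohomology

variable {X : Type*} [MetricSpace X] [MeasurableSpace X]

/-- The operator `u ↦ u ∘ ∂ᵢ` on classes of functions. -/
def faceComp (μ : Measure X) [BoundedGeometry μ] (k : ℕ) (i : Fin (k + 2)) :
    Cochain μ k →ₗ[ℝ] Cochain μ (k + 1) where
  toFun u := u.compQuasiMeasurePreserving (face i) (quasiMeasurePreserving_face μ k i)
  map_add' u v := by
    induction u using AEEqFun.induction_on
    induction v using AEEqFun.induction_on
    rfl
  map_smul' c u := by
    induction u using AEEqFun.induction_on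
    rfl

/-- The formal derivative
`du(x₀, …, x_{k+1}) = ∑ᵢ (-1)ⁱ u(x₀, …, x̂ᵢ, …, x_{k+1})` on classes of functions. -/
def cochainD (μ : Measure X) [BoundedGeometry μ] (k : ℕ) : Cochain μ k →ₗ[ℝ] Cochain μ (k + 1) :=
  ∑ i : Fin (k + 2), (-1 : ℝ) ^ (i : ℕ) • faceComp μ k i

variable [BorelSpace X] (φ : YoungFunction) (μ : Measure X) [BoundedGeometry μ]

theorem faceComp_mem (k : ℕ) (i : Fin (k + 2)) {u : Cochain μ k} (hu : u ∈ ASSubmodule φ μ k) :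
    faceComp μ k i u ∈ ASSubmodule φ μ (k + 1) := by
  intro s hs
  obtain ⟨α, hα, hu⟩ := hu s hs
  obtain ⟨C, hC, h⟩ := exists_lintegral_face_le μ k i s
  have hC0 : 0 < C := by linarith
  refine ⟨α * C, by positivity, ?_⟩
  have e : (α * C)⁻¹ • faceComp μ k i u = faceComp μ k i (C⁻¹ • (α⁻¹ • u)) := by
    rw [← map_smul, smul_smul, mul_inv_rev]
  set w : Cochain μ k := C⁻¹ • (α⁻¹ • u) with hw
  have hwm : modular φ μ s w ≤ ENNReal.ofReal C⁻¹ := by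
    refine (modular_smul_le_mul φ μ s (by positivity) (inv_le_one_of_one_le₀ hC) _).trans ?_
    exact mul_le_of_le_one_right' hu
  rw [e, modular_congr φ μ s (faceComp μ k i w)
    (AEEqFun.coeFn_compQuasiMeasurePreserving w (quasiMeasurePreserving_face μ k i))]
  refine (h (fun Δ => ENNReal.ofReal (φ (w Δ))) (ENNReal.measurable_ofReal.comp
    (φ.continuous.measurable.comp w.measurable))).trans ?_
  calc _ ≤ ENNReal.ofReal C * ENNReal.ofReal C⁻¹ := by gcongr; exact hwm
    _ = 1 := by rw [← ENNReal.ofReal_mul hC0.le, mul_inv_cancel₀ hC0.ne', ENNReal.ofReal_one]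

theorem cochainD_mem (k : ℕ) {u : Cochain μ k} (hu : u ∈ ASSubmodule φ μ k) :
    cochainD μ k u ∈ ASSubmodule φ μ (k + 1) := by
  rw [cochainD, LinearMap.sum_apply]
  exact Submodule.sum_mem _ fun i _ => Submodule.smul_mem _ _ (faceComp_mem φ μ k i hu)

/-- The coboundary operator `d_k : AS_φ^k(X) → AS_φ^{k+1}(X)`. -/
def coboundary (k : ℕ) : AS φ μ k →ₗ[ℝ] AS φ μ (k + 1) :=
  (cochainD μ k).restrict fun _ hu => cochainD_mem φ μ k hu

/-- `Ker d_k`. -/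
def cocycles (k : ℕ) : Submodule ℝ (AS φ μ k) := LinearMap.ker (coboundary φ μ k)

/-- `Im d_{k-1}`, which is `0` for `k = 0`. -/
def coboundaries : (k : ℕ) → Submodule ℝ (AS φ μ k)
  | 0 => ⊥
  | k + 1 => LinearMap.range (coboundary φ μ k)

/-- The asymptotic Orlicz cohomology `L^φ H^k_AS(X) = Ker d_k / Im d_{k-1}`, with the quotient
topology of the subspace topology. -/
abbrev OrliczCohomology (k : ℕ) : Type _ :=
  cocycles φ μ k ⧸ (coboundaries φ μ k).submoduleOf (cocycles φ μ k)

/-- The reduced asymptotic Orlicz cohomology, the quotient of `Ker d_k` by the closure of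
`Im d_{k-1}`, with the quotient topology of the subspace topology. -/
abbrev ReducedOrliczCohomology (k : ℕ) : Type _ :=
  cocycles φ μ k ⧸ (coboundaries φ μ k).topologicalClosure.submoduleOf (cocycles φ μ k)

end Cohomology

/-- Fréchet spaces: Hausdorff, locally convex, metrizable (equivalently, first countable) and
complete topological vector spaces over `ℝ`. -/
structure IsFrechetSpace (E : Type*) [AddCommGroup E] [Module ℝ E] [TopologicalSpace E] :
    Prop where
  isTopologicalAddGroup : IsTopologicalAddGroup E
  continuousSMul : ContinuousSMul ℝ E
  locallyConvex : LocallyConvexSpace ℝ E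
  t2 : T2Space E
  firstCountable : FirstCountableTopology E
  complete : @CompleteSpace E (IsTopologicalAddGroup.rightUniformSpace E)

end

noncomputable section

/-! Composition with a quasi-isometry `F` makes no sense on classes modulo null sets, and `F` need
not be measurable. So `F` is smeared out: `x` is replaced by a probability measure `κ x` on `Y`, of
bounded density with respect to `ν` and supported near `F x` (`exists_isCoarseKernel`), and `u` is
pulled back to its integral against `κ(x₀) ⊗ ⋯ ⊗ κ(x_k)` (`kernelOp`). Jensen's inequality moves `φ`
inside the integral, and the averaged bound `κ ∘ₘ μ ≤ C • ν` turns this into a bound on modulars,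
the support condition only changing the scale `s`. Hence the pullback is continuous
(`continuous_kernelOp`); it commutes with `d` because a face of a product measure is the product
over the face (`coboundary_kernelOp_piKernel`).

With `η` built in the same way from a coarse inverse of `F`, the two pullbacks compose to the one
given by `η ∘ₖ κ`, a kernel close to the identity of `X` (`IsCoarseKernel.comp`). On cocycles such
an operator differs from the identity by a coboundary: the classical prism homotopy is integrated
over the simplices `(x₀, …, xᵢ, yᵢ, …, y_k)` with independent `yⱼ` of law `κ xⱼ`
(`kernelOp_piKernel_sub_mem_coboundaries`). The pair `(xᵢ, yᵢ)` is the reason for asking also for a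
pointwise bound on `κ x`. So the pullbacks are mutually inverse modulo coboundaries and, being
continuous, also modulo the closures.

For the Fréchet property, integral scales give countably many semi-norms. On bounded sets the
modular controls the `L¹` norm, so a fast Cauchy sequence converges almost everywhere, and Fatou's
lemma makes the limit a limit in `AS_φ^k` (`exists_tendsto_of_luxemburg_lt`). The kernel of the
continuous `d_k` is closed, and quotients of Fréchet spaces by closed subspaces are Fréchet. -/

/-! ### Products of measures and of Markov kernels -/

section PiKernel

open ProbabilityTheory

/-- Tonelli's theorem for products of functions of one variable each. -/
theorem lintegral_pi_prod {X : Type*} [MeasurableSpace X] :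
    ∀ {n : ℕ} (μ : Fin n → Measure X) [∀ i, SigmaFinite (μ i)] (f : Fin n → X → ℝ≥0∞),
      (∀ i, Measurable (f i)) →
      ∫⁻ x : Fin n → X, ∏ i, f i (x i) ∂(Measure.pi μ) = ∏ i, ∫⁻ x, f i x ∂(μ i)
  | 0, μ, _, f, _ => by simp
  | n + 1, μ, _, f, hf => by
    have h := measurePreserving_piFinSuccAbove μ 0
    have hm : Measurable fun x : Fin n → X => ∏ i, f i.succ (x i) :=
      Finset.measurable_prod _ fun i _ => (hf i.succ).comp (measurable_pi_apply i)
    have hg : Measurable fun p : X × (Fin n → X) => f 0 p.1 * ∏ i, f i.succ (p.2 i) :=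
      ((hf 0).comp measurable_fst).mul (hm.comp measurable_snd)
    calc ∫⁻ x : Fin (n + 1) → X, ∏ i, f i (x i) ∂(Measure.pi μ)
        = ∫⁻ p : X × (Fin n → X), f 0 p.1 * ∏ i, f i.succ (p.2 i)
            ∂((μ 0).prod (Measure.pi fun i => μ (Fin.succAbove 0 i))) := by
          refine Eq.trans (lintegral_congr fun x => ?_) (h.lintegral_comp hg)
          rw [Fin.prod_univ_succ]
          rfl
      _ = (∫⁻ x, f 0 x ∂(μ 0)) * ∏ i : Fin n, ∫⁻ x, f i.succ x ∂(μ i.succ) := by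
          rw [lintegral_prod_mul (hf 0).aemeasurable hm.aemeasurable,
            lintegral_pi_prod _ (fun i => f i.succ) fun i => hf i.succ]
          rfl
      _ = ∏ i, ∫⁻ x, f i x ∂(μ i) := by rw [Fin.prod_univ_succ]

/-- A measure is dominated by a product measure as soon as it is so on measurable boxes. -/
theorem le_pi_of_boxes {ι X : Type*} [Fintype ι] [MeasurableSpace X]
    (μ : ι → Measure X) (ρ : Measure (ι → X))
    (h : ∀ s : ι → Set X, (∀ i, MeasurableSet (s i)) → ρ (univ.pi s) ≤ ∏ i, μ i (s i)) :
    ρ ≤ Measure.pi μ := by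
  -- `OuterMeasure.pi` is the largest outer measure bounded on boxes by the product of the sides, so
  -- no σ-finiteness is involved.
  have key : ρ.toOuterMeasure ≤ OuterMeasure.pi fun i => (μ i).toOuterMeasure := by
    rw [OuterMeasure.le_pi]
    intro s _
    calc ρ (univ.pi s) ≤ ρ (univ.pi fun i => toMeasurable (μ i) (s i)) :=
          measure_mono (pi_mono fun i _ => subset_toMeasurable _ _)
      _ ≤ ∏ i, μ i (toMeasurable (μ i) (s i)) := h _ fun i => measurableSet_toMeasurable _ _
      _ = _ := Finset.prod_congr rfl fun i _ => measure_toMeasurable _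
  refine Measure.le_iff.2 fun s hs => ?_
  rw [Measure.pi, toMeasure_apply _ _ hs]
  exact key s

/-- Dividing `ρ` by `C` reduces to the case `C = 1`; this is why `C` may be neither `0` nor `∞`. -/
theorem le_smul_pi_of_boxes {ι X : Type*} [Fintype ι] [MeasurableSpace X]
    (μ : ι → Measure X) (ρ : Measure (ι → X)) {C : ℝ≥0∞} (h0 : C ≠ 0) (ht : C ≠ ∞)
    (h : ∀ s : ι → Set X, (∀ i, MeasurableSet (s i)) → ρ (univ.pi s) ≤ C * ∏ i, μ i (s i)) :
    ρ ≤ C • Measure.pi μ := by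
  have := le_pi_of_boxes μ (C⁻¹ • ρ) fun s hs => by
    rw [Measure.smul_apply, smul_eq_mul, mul_comm, ← div_eq_mul_inv]
    exact ENNReal.div_le_of_le_mul' (h s hs)
  refine Measure.le_iff.2 fun s hs => ?_
  have hs := this s
  rw [Measure.smul_apply, smul_eq_mul, mul_comm, ← div_eq_mul_inv] at hs
  rw [Measure.smul_apply, smul_eq_mul, mul_comm]
  exact (ENNReal.div_le_iff h0 ht).1 hs

variable {X Y Z : Type*} [MeasurableSpace X] [MeasurableSpace Y] [MeasurableSpace Z]

/-- The product Markov kernel `(x₀, …, x_k) ↦ κ(x₀) ⊗ ⋯ ⊗ κ(x_k)`. -/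
def piKernel (κ : Kernel X Y) [IsMarkovKernel κ] (n : ℕ) : Kernel (Fin n → X) (Fin n → Y) where
  toFun x := Measure.pi fun i => κ (x i)
  measurable' := by
    refine Measurable.measure_of_isPiSystem_of_isProbabilityMeasure generateFrom_pi.symm
      isPiSystem_pi ?_
    rintro _ ⟨s, hs, rfl⟩
    simp only [Measure.pi_pi]
    exact Finset.measurable_prod _ fun i _ =>
      (κ.measurable_coe (hs i (mem_univ i))).comp (measurable_pi_apply i)

variable (κ : Kernel X Y) [IsMarkovKernel κ]

theorem piKernel_apply (n : ℕ) (x : Fin n → X) :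
    piKernel κ n x = Measure.pi fun i => κ (x i) := rfl

instance (n : ℕ) : IsMarkovKernel (piKernel κ n) :=
  ⟨fun x => by rw [piKernel_apply]; infer_instance⟩

/-- By Tonelli on boxes. It identifies the round trip from `X` to `Y` and back with a single product
kernel. -/
theorem piKernel_comp (η : Kernel Y Z) [IsMarkovKernel η] (n : ℕ) :
    piKernel η n ∘ₖ piKernel κ n = piKernel (η ∘ₖ κ) n := by
  ext1 x
  symm
  rw [piKernel_apply]
  refine Measure.pi_eq fun s hs => ?_
  rw [Kernel.comp_apply' _ _ _ (MeasurableSet.univ_pi hs)]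
  simp only [piKernel_apply, Measure.pi_pi]
  have : ∀ i, (η ∘ₖ κ) (x i) (s i) = ∫⁻ y, η y (s i) ∂κ (x i) := fun i =>
    Kernel.comp_apply' _ _ _ (hs i)
  simp only [this]
  exact lintegral_pi_prod (fun i => κ (x i)) (fun i y => η y (s i)) fun i =>
    η.measurable_coe (hs i)

/-- Forgetting a vertex integrates out a factor of mass one. This is what makes the pullback commute
with `d`. -/
theorem piKernel_map_face {k : ℕ} (i : Fin (k + 2)) (x : Fin (k + 2) → X) :
    (piKernel κ (k + 2) x).map (face i) = piKernel κ (k + 1) (face i x) := by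
  have h := measurePreserving_piFinSuccAbove (fun j : Fin (k + 2) => κ (x j)) i
  exact (measurePreserving_snd.comp h).map_eq

/-! ### Prisms -/

/-- The `i`-th simplex `(x₀, …, xᵢ, y_i, …, y_k)` of the prism over the simplex
`((x₀, y₀), …, (x_k, y_k))`. -/
def prism {X : Type*} {k : ℕ} (i : Fin (k + 1)) (z : Fin (k + 1) → X × X) : Fin (k + 2) → X :=
  fun l => if l ≤ i.castSucc then (z (i.predAbove l)).1 else (z (i.predAbove l)).2

theorem measurable_prism {k : ℕ} (i : Fin (k + 1)) : Measurable (prism (X := X) i) := by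
  refine measurable_pi_lambda _ fun l => ?_
  unfold prism
  split_ifs
  · exact measurable_fst.comp (measurable_pi_apply _)
  · exact measurable_snd.comp (measurable_pi_apply _)

/-- The preimage of a box is again a box, in the pairs `z j`. Only `j = i` constrains both
components of its pair. -/
theorem prism_mem_pi_iff {X : Type*} {k : ℕ} (i : Fin (k + 1)) (z : Fin (k + 1) → X × X)
    (B : Fin (k + 2) → Set X) : prism i z ∈ univ.pi B ↔ ∀ j : Fin (k + 1),
      ((j ≤ i → (z j).1 ∈ B j.castSucc) ∧ (i ≤ j → (z j).2 ∈ B j.succ)) := by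
  simp only [mem_univ_pi, prism]
  constructor
  · intro h j
    refine ⟨fun hj => ?_, fun hj => ?_⟩
    · have := h j.castSucc
      rwa [if_pos (Fin.castSucc_le_castSucc_iff.2 hj), Fin.predAbove_castSucc_of_le _ _ hj] at this
    · have := h j.succ
      rwa [if_neg (by simp [Fin.le_def, Fin.le_def.1 hj]),
        Fin.predAbove_succ_of_le _ _ hj] at this
  · intro h l
    split_ifs with hl
    · obtain ⟨j, rfl⟩ := Fin.exists_castSucc_eq.2 (ne_of_lt (hl.trans_lt (Fin.castSucc_lt_last i)))
      have hj := Fin.castSucc_le_castSucc_iff.1 hl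
      rw [Fin.predAbove_castSucc_of_le _ _ hj]
      exact (h j).1 hj
    · rw [not_le] at hl
      obtain ⟨j, rfl⟩ := Fin.exists_succ_eq.2 (ne_of_gt ((Fin.zero_le _).trans_lt hl))
      have hj : i ≤ j := by
        simp only [Fin.lt_def, Fin.val_castSucc, Fin.val_succ] at hl
        exact Fin.le_def.2 (by omega)
      rw [Fin.predAbove_succ_of_le _ _ hj]
      exact (h j).2 hj

/-- Regroups the vertices of a prism simplex over those of its base: index `i` receives two factors,
the others one. -/
theorem prod_prism_eq {M : Type*} [CommMonoid M] {k : ℕ} (i : Fin (k + 1)) (b : Fin (k + 2) → M) :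
    ∏ l, b l = ∏ j : Fin (k + 1),
      ((if j ≤ i then b j.castSucc else 1) * (if i ≤ j then b j.succ else 1)) := by
  have h : ∀ j : Fin (k + 1),
      (if j ≤ i then b j.castSucc else 1) * (if i ≤ j then b j.succ else 1) =
        (if j = i then b i.succ else 1) * b (i.succ.succAbove j) := by
    intro j
    rcases lt_trichotomy j i with hj | rfl | hj
    · rw [if_pos hj.le, if_neg hj.not_ge, if_neg hj.ne, mul_one, one_mul,
        Fin.succAbove_of_castSucc_lt]
      exact Fin.castSucc_lt_succ_iff.2 hj.le
    · rw [if_pos le_rfl, if_pos le_rfl, if_pos rfl, mul_comm, Fin.succAbove_of_castSucc_lt]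
      exact Fin.castSucc_lt_succ
    · rw [if_neg hj.not_ge, if_pos hj.le, if_neg hj.ne', one_mul, one_mul,
        Fin.succAbove_of_le_castSucc]
      exact Fin.succ_le_castSucc_iff.2 hj
  rw [Finset.prod_congr rfl fun j _ => h j, Finset.prod_mul_distrib, Finset.prod_ite_eq',
    if_pos (Finset.mem_univ _), Fin.prod_univ_succAbove b i.succ]

/-- The kernel sending `x` to the law of `(x, y)`, where `y` has law `κ x`. -/
def graphKernel (κ : Kernel X Y) : Kernel X (X × Y) := Kernel.id ×ₖ κ

instance : IsMarkovKernel (graphKernel κ) := by unfold graphKernel; infer_instance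

theorem graphKernel_apply (x : X) : graphKernel κ x = (Measure.dirac x).prod (κ x) := by
  rw [graphKernel, Kernel.prod_apply, Kernel.id_apply]

theorem graphKernel_map_fst (x : X) : (graphKernel κ x).map Prod.fst = Measure.dirac x := by
  rw [graphKernel_apply]; exact measurePreserving_fst.map_eq

theorem graphKernel_map_snd (x : X) : (graphKernel κ x).map Prod.snd = κ x := by
  rw [graphKernel_apply]; exact measurePreserving_snd.map_eq

/-- The image of the product of the laws of `(xⱼ, yⱼ)`, `yⱼ ∼ κ xⱼ`, under the `i`-th prism map. -/
def prismKernel (κ : Kernel X X) [IsMarkovKernel κ] {k : ℕ} (i : Fin (k + 1)) :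
    Kernel (Fin (k + 1) → X) (Fin (k + 2) → X) :=
  (piKernel (graphKernel κ) (k + 1)).map (prism i)

instance (κ : Kernel X X) [IsMarkovKernel κ] {k : ℕ} (i : Fin (k + 1)) :
    IsMarkovKernel (prismKernel κ i) := Kernel.IsMarkovKernel.map _ (measurable_prism i)

/-- On boxes Tonelli splits both sides, and each factor costs one `C`. -/
theorem piKernel_comp_le (μ : Measure X) (ν : Measure Y) [SigmaFinite μ] {C : ℝ≥0∞}
    (h0 : C ≠ 0) (ht : C ≠ ∞) (h : κ ∘ₘ μ ≤ C • ν) (n : ℕ) :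
    piKernel κ n ∘ₘ (Measure.pi fun _ => μ) ≤ C ^ n • Measure.pi fun _ => ν := by
  refine le_smul_pi_of_boxes _ _ (pow_ne_zero _ h0) (ENNReal.pow_ne_top ht) fun s hs => ?_
  rw [Measure.bind_apply (MeasurableSet.univ_pi hs) (Kernel.aemeasurable _)]
  simp only [piKernel_apply, Measure.pi_pi]
  rw [lintegral_pi_prod (fun _ => μ) (fun i x => κ x (s i)) fun i => κ.measurable_coe (hs i)]
  calc ∏ i, ∫⁻ x, κ x (s i) ∂μ ≤ ∏ i : Fin n, C * ν (s i) := by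
        refine Finset.prod_le_prod' fun i _ => ?_
        rw [← Measure.bind_apply (hs i) (Kernel.aemeasurable _)]
        exact h (s i)
    _ = _ := by rw [Finset.prod_mul_distrib, Finset.prod_const, Finset.card_univ, Fintype.card_fin]

/-- On boxes the estimate splits over `j`. For `j < i` only `xⱼ` occurs, and for `j > i` only `yⱼ`,
whose averaged law is bounded by `h`. For `j = i` the joint law of `(xᵢ, yᵢ)` has to be dominated by
`C • μ ⊗ μ`, which takes the pointwise bound `h'`. -/
theorem prismKernel_comp_le (κ : Kernel X X) [IsMarkovKernel κ] (μ : Measure X) [SigmaFinite μ]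
    {C : ℝ≥0∞} (h1 : 1 ≤ C) (ht : C ≠ ∞) (h : κ ∘ₘ μ ≤ C • μ) (h' : ∀ x, κ x ≤ C • μ) {k : ℕ}
    (i : Fin (k + 1)) : prismKernel κ i ∘ₘ (Measure.pi fun _ => μ) ≤
      C ^ (k + 1) • Measure.pi fun _ => μ := by
  have h0 : C ≠ 0 := (one_pos.trans_le h1).ne'
  refine le_smul_pi_of_boxes _ _ (pow_ne_zero _ h0) (ENNReal.pow_ne_top ht) fun B hB => ?_
  set D : Fin (k + 1) → Set (X × X) := fun j =>
    (if j ≤ i then B j.castSucc else univ) ×ˢ (if i ≤ j then B j.succ else univ) with hD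
  have hDm1 : ∀ j, MeasurableSet (if j ≤ i then B j.castSucc else univ) := fun j => by
    split_ifs; exacts [hB _, MeasurableSet.univ]
  have hDm2 : ∀ j, MeasurableSet (if i ≤ j then B j.succ else univ) := fun j => by
    split_ifs; exacts [hB _, MeasurableSet.univ]
  have hpre : prism i ⁻¹' univ.pi B = univ.pi D := by
    ext z
    rw [mem_preimage, prism_mem_pi_iff, mem_univ_pi]
    refine forall_congr' fun j => ?_
    simp only [hD, mem_prod]
    refine and_congr ?_ ?_ <;> split_ifs with hj <;> simp [hj]
  rw [Measure.bind_apply (MeasurableSet.univ_pi hB) (Kernel.aemeasurable _)]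
  simp only [prismKernel, Kernel.map_apply' _ (measurable_prism i) _ (MeasurableSet.univ_pi hB),
    hpre, piKernel_apply, Measure.pi_pi]
  rw [lintegral_pi_prod (fun _ => μ) (fun j x => graphKernel κ x (D j)) fun j =>
    (graphKernel κ).measurable_coe ((hDm1 j).prod (hDm2 j)), prod_prism_eq i]
  calc ∏ j, ∫⁻ x, graphKernel κ x (D j) ∂μ ≤ ∏ j : Fin (k + 1), C *
        ((if j ≤ i then μ (B j.castSucc) else 1) * (if i ≤ j then μ (B j.succ) else 1)) := by
        refine Finset.prod_le_prod' fun j _ => ?_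
        have e : ∀ x, graphKernel κ x (D j) =
            (if j ≤ i then B j.castSucc else univ).indicator 1 x *
              κ x (if i ≤ j then B j.succ else univ) := fun x => by
          rw [graphKernel_apply, hD, Measure.prod_prod, Measure.dirac_apply' _ (hDm1 j)]
        simp only [e]
        by_cases h3 : j ≤ i <;> by_cases h4 : i ≤ j
        · simp only [if_pos h3, if_pos h4]
          calc _ ≤ ∫⁻ x, (B j.castSucc).indicator 1 x * (C * μ (B j.succ)) ∂μ :=
                lintegral_mono fun x => mul_le_mul_right (h' x _) _
            _ = _ := by
                rw [lintegral_mul_const _ (measurable_one.indicator (hB _)),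
                  lintegral_indicator_one (hB _)]
                ring
        · simp only [if_pos h3, if_neg h4, measure_univ, mul_one]
          rw [lintegral_indicator_one (hB _)]
          exact le_mul_of_one_le_left' h1
        · simp only [if_neg h3, if_pos h4, indicator_univ, Pi.one_apply, one_mul]
          rw [← Measure.bind_apply (hB _) (Kernel.aemeasurable _)]
          exact h _
        · exact absurd (le_total j i) (by tauto)
    _ = _ := by rw [Finset.prod_mul_distrib, Finset.prod_const, Finset.card_univ, Fintype.card_fin]

end PiKernel

/-! ### Operators on cochains given by Markov kernels -/

namespace YoungFunction

variable (φ : YoungFunction)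

theorem map_one_pos : 0 < φ 1 :=
  (φ.nonneg' 1).lt_of_ne' fun h => one_ne_zero ((φ.eq_zero_iff' 1).1 h)

/-- By convexity `φ` grows at least linearly beyond `1`. This is how modulars control integrability
and `L¹` norms. -/
theorem abs_le (t : ℝ) : |t| ≤ 1 + φ t / φ 1 := by
  have h1 := φ.map_one_pos
  rcases le_total |t| 1 with h | h
  · exact h.trans (le_add_of_nonneg_right (div_nonneg (φ.nonneg' _) h1.le))
  · have h0 : 0 < |t| := by linarith
    have := φ.map_smul_le (inv_nonneg.2 h0.le) (inv_le_one_of_one_le₀ h) |t|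
    rw [inv_mul_cancel₀ h0.ne', φ.map_abs, inv_mul_eq_div, le_div_iff₀ h0] at this
    have h2 : |t| ≤ φ t / φ 1 := by rw [le_div_iff₀ h1, mul_comm]; exact this
    linarith

theorem measurable_ofReal_comp {A : Type*} [MeasurableSpace A] {f : A → ℝ} (hf : Measurable f) :
    Measurable fun a => ENNReal.ofReal (φ (f a)) :=
  ENNReal.measurable_ofReal.comp (φ.continuous.measurable.comp hf)

theorem integrable_of_lintegral_lt_top {A : Type*} [MeasurableSpace A] (P : Measure A)
    [IsFiniteMeasure P] {f : A → ℝ} (hf : Measurable f) {c : ℝ} (hc : c ≠ 0)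
    (h : ∫⁻ a, ENNReal.ofReal (φ (c * f a)) ∂P < ∞) : Integrable f P := by
  have hm : Measurable fun a => φ (c * f a) := φ.continuous.measurable.comp (hf.const_mul c)
  have hi : Integrable (fun a => φ (c * f a)) P :=
    ⟨hm.aestronglyMeasurable, by
      rwa [hasFiniteIntegral_iff_ofReal (ae_of_all _ fun a => φ.nonneg' _)]⟩
  have hb : Integrable (fun a => c * f a) P := by
    refine ((integrable_const 1).add (hi.div_const (φ 1))).mono'
      (hf.const_mul c).aestronglyMeasurable (ae_of_all _ fun a => ?_)
    exact φ.abs_le _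
  exact (integrable_const_mul_iff (IsUnit.mk0 c hc) f).1 hb

/-- Jensen's inequality for Young functions. -/
theorem map_integral_le {A : Type*} [MeasurableSpace A] (P : Measure A) [IsProbabilityMeasure P]
    {f : A → ℝ} (hf : Measurable f) :
    ENNReal.ofReal (φ (∫ a, f a ∂P)) ≤ ∫⁻ a, ENNReal.ofReal (φ (f a)) ∂P := by
  -- If the right side is finite, `f` is integrable by linear growth, so integrability need not be
  -- assumed.
  rcases eq_or_ne (∫⁻ a, ENNReal.ofReal (φ (f a)) ∂P) ∞ with h | h
  · rw [h]; exact le_top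
  have hm : Measurable fun a => φ (f a) := φ.continuous.measurable.comp hf
  have hi : Integrable (fun a => φ (f a)) P :=
    ⟨hm.aestronglyMeasurable, by
      rw [hasFiniteIntegral_iff_ofReal (ae_of_all _ fun a => φ.nonneg' _)]; exact h.lt_top⟩
  have hf' : Integrable f P := φ.integrable_of_lintegral_lt_top P hf one_ne_zero (by
    simpa only [one_mul] using h.lt_top)
  rw [← ofReal_integral_eq_lintegral_ofReal hi (ae_of_all _ fun a => φ.nonneg' _)]
  exact ENNReal.ofReal_le_ofReal (φ.convex'.map_integral_le φ.continuous.continuousOn isClosed_univ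
    (ae_of_all _ fun _ => mem_univ _) hf' hi)

end YoungFunction

/-! ### Small simplices and measurable hulls for them. -/

section SmallSimplices

variable {X : Type*} [MetricSpace X]

theorem mem_smallSimplices_of_dist_le {k : ℕ} {s : ℝ} (hs : 0 ≤ s) {Δ : Fin (k + 1) → X}
    (h : ∀ i j, dist (Δ i) (Δ j) ≤ s) : Δ ∈ smallSimplices X k s := by
  refine Metric.diam_le_of_forall_dist_le hs ?_
  rintro _ ⟨i, rfl⟩ _ ⟨j, rfl⟩
  exact h i j

theorem smallSimplices_mono {k : ℕ} {s t : ℝ} (h : s ≤ t) :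
    smallSimplices X k s ⊆ smallSimplices X k t := fun _ hΔ => le_trans hΔ h

theorem iUnion_smallSimplices (k : ℕ) : ⋃ n : ℕ, smallSimplices X k (n + 1) = univ := by
  refine eq_univ_of_forall fun Δ => ?_
  obtain ⟨n, hn⟩ := exists_nat_ge (Metric.diam (range Δ))
  exact mem_iUnion.2 ⟨n, hn.trans (by linarith)⟩

variable [MeasurableSpace X]

theorem ae_of_ae_smallSimplices (μ : Measure X) {k : ℕ} {p : (Fin (k + 1) → X) → Prop}
    (h : ∀ s : ℝ, 0 < s → ∀ᵐ Δ ∂(simplexMeasure μ k).restrict (smallSimplices X k s), p Δ) :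
    ∀ᵐ Δ ∂simplexMeasure μ k, p Δ := by
  rw [← Measure.restrict_univ (μ := simplexMeasure μ k), ← iUnion_smallSimplices,
    ae_restrict_iUnion_iff]
  exact fun n => h _ (by positivity)

/-- As `X` need not be separable, the set of small simplices may fail to be measurable for the
product σ-algebra. A countable net squeezes a countable union of boxes between two scales. -/
theorem exists_measurableSet_smallSimplices [BorelSpace X] (μ : Measure X) [BoundedGeometry μ]
    (k : ℕ) (s : ℝ) : ∃ (W : Set (Fin (k + 1) → X)) (t : ℝ), 0 < t ∧ MeasurableSet W ∧
      smallSimplices X k s ⊆ W ∧ W ⊆ smallSimplices X k t := by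
  obtain ⟨N, R, hNc, hN⟩ := exists_countable_net μ
  -- The maximum with `1` keeps `t` positive whatever the sign of `s + R`.
  refine ⟨⋃ n ∈ N, univ.pi fun _ => Metric.ball n (s + R), max 1 (2 * (s + R)), by positivity,
    MeasurableSet.biUnion hNc fun n _ => MeasurableSet.univ_pi fun _ =>
      Metric.isOpen_ball.measurableSet, fun Δ hΔ => ?_, fun Δ hΔ => ?_⟩
  · obtain ⟨n, hn, hd⟩ := hN (Δ 0)
    refine mem_biUnion hn fun i _ => ?_
    have := dist_le_of_mem_smallSimplices hΔ i 0
    exact (dist_triangle _ (Δ 0) _).trans_lt (by linarith)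
  · obtain ⟨n, hn, hd⟩ := mem_iUnion₂.1 hΔ
    refine mem_smallSimplices_of_dist_le (by positivity) fun i j => le_max_of_le_right ?_
    have h1 : dist (Δ i) n < s + R := hd i (mem_univ _)
    have h2 : dist (Δ j) n < s + R := hd j (mem_univ _)
    linarith [dist_triangle_right (Δ i) (Δ j) n]

end SmallSimplices

/-! ### Controlled kernels and the operators they define. -/

section KernelOperators

open ProbabilityTheory

variable {X Y : Type*} [MetricSpace X] [MeasurableSpace X] [MetricSpace Y] [MeasurableSpace Y]
  (φ : YoungFunction) (μ : Measure X) (ν : Measure Y)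

/-- Integration against the kernel `P` over small simplices of `X` is controlled by integration
over small simplices of `Y`. -/
def ControlledKernel {m n : ℕ} (P : Kernel (Fin (m + 1) → X) (Fin (n + 1) → Y)) : Prop :=
  ∀ s : ℝ, 0 < s → ∃ C t : ℝ, 1 ≤ C ∧ 0 < t ∧ ∀ f : (Fin (n + 1) → Y) → ℝ≥0∞, Measurable f →
    ∫⁻ Δ in smallSimplices X m s, ∫⁻ Δ', f Δ' ∂P Δ ∂simplexMeasure μ m ≤
      ENNReal.ofReal C * ∫⁻ Δ' in smallSimplices Y n t, f Δ' ∂simplexMeasure ν n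

variable {μ ν}

/-- For small `Δ` the measure `P Δ` lives in a measurable set `W` of small simplices, so `f` may be
cut off to `W`. After that the integral over `Δ` can be extended to the whole space, where the
domination applies. -/
theorem ControlledKernel.of_comp_le [BorelSpace X] [BoundedGeometry μ] [BorelSpace Y]
    [BoundedGeometry ν] {m n : ℕ}
    {P : Kernel (Fin (m + 1) → X) (Fin (n + 1) → Y)} {C : ℝ≥0∞} (hC : C ≠ ∞)
    (hP : P ∘ₘ simplexMeasure μ m ≤ C • simplexMeasure ν n)
    (hsupp : ∀ s : ℝ, ∃ t : ℝ, ∀ Δ ∈ smallSimplices X m s, ∀ᵐ Δ' ∂P Δ,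
      Δ' ∈ smallSimplices Y n t) : ControlledKernel μ ν P := by
  intro s _
  obtain ⟨V, s', -, hV, hsV, hVs⟩ := exists_measurableSet_smallSimplices μ m s
  obtain ⟨t', ht'⟩ := hsupp s'
  obtain ⟨W, t, ht, hW, htW, hWt⟩ := exists_measurableSet_smallSimplices ν n t'
  refine ⟨max 1 C.toReal, t, le_max_left _ _, ht, fun f hf => ?_⟩
  calc ∫⁻ Δ in smallSimplices X m s, ∫⁻ Δ', f Δ' ∂P Δ ∂simplexMeasure μ m
      ≤ ∫⁻ Δ in V, ∫⁻ Δ', f Δ' ∂P Δ ∂simplexMeasure μ m := lintegral_mono_set hsV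
    _ ≤ ∫⁻ Δ in V, ∫⁻ Δ', W.indicator f Δ' ∂P Δ ∂simplexMeasure μ m := by
        refine lintegral_mono_ae (ae_restrict_of_forall_mem hV fun Δ hΔ => lintegral_mono_ae ?_)
        filter_upwards [ht' Δ (hVs hΔ)] with Δ' h
        rw [indicator_of_mem (htW h)]
    _ ≤ ∫⁻ Δ, ∫⁻ Δ', W.indicator f Δ' ∂P Δ ∂simplexMeasure μ m := setLIntegral_le_lintegral _ _
    _ = ∫⁻ Δ', W.indicator f Δ' ∂(P ∘ₘ simplexMeasure μ m) :=
        (Measure.lintegral_bind (Kernel.aemeasurable _) (hf.indicator hW).aemeasurable).symm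
    _ ≤ ∫⁻ Δ', W.indicator f Δ' ∂(C • simplexMeasure ν n) := lintegral_mono' hP le_rfl
    _ = C * ∫⁻ Δ' in W, f Δ' ∂simplexMeasure ν n := by
        rw [lintegral_smul_measure, lintegral_indicator hW, smul_eq_mul]
    _ ≤ _ := by
        gcongr
        exact (ENNReal.ofReal_toReal hC).symm.le.trans
          (ENNReal.ofReal_le_ofReal (le_max_right _ _))

/-- The control applied to the indicator of a null set. It lets almost-everywhere identities be used
under the kernel. -/
theorem ControlledKernel.ae_ae {m n : ℕ} {P : Kernel (Fin (m + 1) → X) (Fin (n + 1) → Y)}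
    (hP : ControlledKernel μ ν P) {p : (Fin (n + 1) → Y) → Prop}
    (h : ∀ᵐ Δ' ∂simplexMeasure ν n, p Δ') : ∀ᵐ Δ ∂simplexMeasure μ m, ∀ᵐ Δ' ∂P Δ, p Δ' := by
  refine ae_of_ae_smallSimplices μ fun s hs => ?_
  obtain ⟨C, t, -, -, hC⟩ := hP s hs
  obtain ⟨N, hpN, hN, hN0⟩ := exists_measurable_superset_of_null (ae_iff.1 h)
  have := hC (N.indicator 1) (measurable_one.indicator hN)
  rw [lintegral_indicator_one hN, Measure.restrict_apply hN,
    measure_mono_null inter_subset_left hN0, mul_zero, nonpos_iff_eq_zero,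
    lintegral_eq_zero_iff (measurable_one.indicator hN).lintegral_kernel] at this
  filter_upwards [this] with Δ hΔ
  rw [lintegral_indicator_one hN] at hΔ
  exact measure_mono_null hpN hΔ

theorem ControlledKernel.modular_le {m n : ℕ}
    {P : Kernel (Fin (m + 1) → X) (Fin (n + 1) → Y)} (hP : ControlledKernel μ ν P)
    [IsMarkovKernel P] {s : ℝ} (hs : 0 < s) :
    ∃ C t : ℝ, 1 ≤ C ∧ 0 < t ∧ ∀ f : (Fin (n + 1) → Y) → ℝ, Measurable f →
    ∫⁻ Δ in smallSimplices X m s, ENNReal.ofReal (φ (∫ Δ', f Δ' ∂P Δ)) ∂simplexMeasure μ m ≤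
      ENNReal.ofReal C *
        ∫⁻ Δ' in smallSimplices Y n t, ENNReal.ofReal (φ (f Δ')) ∂simplexMeasure ν n := by
  obtain ⟨C, t, hC, ht, h⟩ := hP s hs
  refine ⟨C, t, hC, ht, fun f hf => ?_⟩
  exact (lintegral_mono fun Δ => φ.map_integral_le (P Δ) hf).trans
    (h _ (φ.measurable_ofReal_comp hf))

/-- Finiteness of the modular of `α⁻¹ • u` passes to almost every `P Δ`, where linear growth of `φ`
gives integrability. -/
theorem ControlledKernel.ae_integrable {m n : ℕ}
    {P : Kernel (Fin (m + 1) → X) (Fin (n + 1) → Y)} (hP : ControlledKernel μ ν P)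
    [IsMarkovKernel P] {u : Cochain ν n}
    (hu : u ∈ ASSubmodule φ ν n) : ∀ᵐ Δ ∂simplexMeasure μ m, Integrable u (P Δ) := by
  refine ae_of_ae_smallSimplices μ fun s hs => ?_
  obtain ⟨C, t, -, ht, hC⟩ := hP s hs
  obtain ⟨α, hα, hu⟩ := hu t ht
  have hm : Measurable fun Δ' => ENNReal.ofReal (φ (α⁻¹ * u Δ')) :=
    φ.measurable_ofReal_comp (u.measurable.const_mul _)
  have h := hC _ hm
  rw [← modular_smul] at h
  have hlt := ae_lt_top hm.lintegral_kernel
    (h.trans_lt (ENNReal.mul_lt_top ENNReal.ofReal_lt_top (hu.trans_lt ENNReal.one_lt_top))).ne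
  filter_upwards [hlt] with Δ hΔ
  exact φ.integrable_of_lintegral_lt_top (P Δ) u.measurable (inv_ne_zero hα.ne') hΔ

/-- Since `φ(t / C) ≤ φ(t) / C` for `C ≥ 1`, a factor in front of a modular is absorbed by rescaling
the argument. Modular bounds thus become semi-norm bounds with the same constant. -/
theorem mul_modular_le_one {k : ℕ} {C α t : ℝ} (hC : 1 ≤ C) {u : Cochain μ k}
    (hu : modular φ μ t (α⁻¹ • u) ≤ 1) :
    ENNReal.ofReal C * modular φ μ t ((C * α)⁻¹ • u) ≤ 1 := by
  have hC0 : 0 < C := by linarith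
  rw [mul_inv, ← smul_smul]
  calc _ ≤ ENNReal.ofReal C * (ENNReal.ofReal C⁻¹ * 1) := by
        gcongr
        refine (modular_smul_le_mul φ μ t (by positivity) (inv_le_one_of_one_le₀ hC) _).trans ?_
        gcongr
    _ = 1 := by
        rw [mul_one, ← ENNReal.ofReal_mul hC0.le, mul_inv_cancel₀ hC0.ne', ENNReal.ofReal_one]

/-- A linear map between spaces of cochains that is bounded for the modulars is continuous. -/
theorem continuous_of_modular_le {m n : ℕ} (A : AS φ ν n →ₗ[ℝ] AS φ μ m)
    (h : ∀ s : ℝ, 0 < s → ∃ C t : ℝ, 1 ≤ C ∧ 0 < t ∧ ∀ u, modular φ μ s (AS.toCochain φ μ m (A u)) ≤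
      ENNReal.ofReal C * modular φ ν t (AS.toCochain φ ν n u)) : Continuous A := by
  refine WithSeminorms.continuous_of_isBounded (withSeminorms_luxemburg φ ν n)
    (withSeminorms_luxemburg φ μ m) A fun s => ?_
  obtain ⟨C, t, hC, ht, h⟩ := h s s.2
  have hC0 : 0 < C := by linarith
  -- If `α` is admissible for `u` at scale `t`, then `C * α` is admissible for `A u` at scale `s`.
  refine ⟨{⟨t, ht⟩}, ⟨C, hC0.le⟩, fun u => ?_⟩
  rw [Finset.sup_singleton]
  change luxemburg φ μ m s (A u) ≤ C * luxemburg φ ν n ⟨t, ht⟩ u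
  rw [← div_le_iff₀' hC0, luxemburg_apply φ ν n]
  refine le_csInf (u.2 t ht) fun α hα => ?_
  rw [div_le_iff₀' hC0, luxemburg_apply]
  refine csInf_le ⟨0, fun _ h => h.1.le⟩ ⟨mul_pos hC0 hα.1, ?_⟩
  rw [← map_smul, ← map_smul]
  refine (h _).trans ?_
  rw [map_smul]
  exact mul_modular_le_one φ hC hα.2

variable {m n : ℕ} (P : Kernel (Fin (m + 1) → X) (Fin (n + 1) → Y)) [IsMarkovKernel P]
  (hP : ControlledKernel μ ν P)

/-- The class of `Δ ↦ ∫ u dP(Δ)`. -/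
def kernelCochain (u : Cochain ν n) : Cochain μ m :=
  AEEqFun.mk (fun Δ => ∫ Δ', u Δ' ∂P Δ)
    (AEEqFun.stronglyMeasurable u).integral_kernel.aestronglyMeasurable

theorem coeFn_kernelCochain (u : Cochain ν n) :
    (kernelCochain P u : Cochain μ m) =ᵐ[simplexMeasure μ m] fun Δ => ∫ Δ', u Δ' ∂P Δ :=
  AEEqFun.coeFn_mk _ _

/-- Homogeneity needs no integrability, so it holds on all classes; additivity is available only on
`AS_φ`. -/
theorem kernelCochain_smul (hP : ControlledKernel μ ν P) (c : ℝ) (u : Cochain ν n) :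
    (kernelCochain P (c • u) : Cochain μ m) = c • kernelCochain P u := by
  refine AEEqFun.ext ?_
  filter_upwards [coeFn_kernelCochain (μ := μ) P (c • u), coeFn_kernelCochain (μ := μ) P u,
    AEEqFun.coeFn_smul c (kernelCochain P u : Cochain μ m),
    hP.ae_ae (AEEqFun.coeFn_smul c u)] with Δ h1 h2 h3 h4
  rw [h1, h3, Pi.smul_apply, h2, integral_congr_ae h4]
  exact integral_const_mul _ _

theorem modular_kernelCochain_le (hP : ControlledKernel μ ν P) {s : ℝ} (hs : 0 < s) :
    ∃ C t : ℝ, 1 ≤ C ∧ 0 < t ∧ ∀ u : Cochain ν n,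
      modular φ μ s (kernelCochain P u) ≤ ENNReal.ofReal C * modular φ ν t u := by
  obtain ⟨C, t, hC, ht, h⟩ := hP.modular_le φ hs
  refine ⟨C, t, hC, ht, fun u => ?_⟩
  rw [modular_congr φ μ s _ (coeFn_kernelCochain P u)]
  exact h u u.measurable

theorem kernelCochain_mem (hP : ControlledKernel μ ν P) {u : Cochain ν n}
    (hu : u ∈ ASSubmodule φ ν n) : kernelCochain P u ∈ ASSubmodule φ μ m := by
  intro s hs
  obtain ⟨C, t, hC, ht, h⟩ := modular_kernelCochain_le φ P hP hs
  obtain ⟨α, hα, hu⟩ := hu t ht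
  refine ⟨C * α, by positivity, ?_⟩
  rw [← kernelCochain_smul P hP]
  exact (h _).trans (mul_modular_le_one φ hC hu)

/-- The operator `u ↦ ∫ u dP` on Alexander-Spanier cochains given by a controlled Markov
kernel `P`. -/
def kernelOp : AS φ ν n →ₗ[ℝ] AS φ μ m where
  toFun u := (⟨kernelCochain P (AS.toCochain φ ν n u), kernelCochain_mem φ P hP u.2⟩ :
    ASSubmodule φ μ m)
  map_add' u v := by
    refine Subtype.ext (AEEqFun.ext ?_)
    change (kernelCochain P (AS.toCochain φ ν n u + AS.toCochain φ ν n v) : Cochain μ m)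
      =ᵐ[simplexMeasure μ m] (kernelCochain P (AS.toCochain φ ν n u) +
        kernelCochain P (AS.toCochain φ ν n v) : Cochain μ m)
    set u' := AS.toCochain φ ν n u
    set v' := AS.toCochain φ ν n v
    filter_upwards [coeFn_kernelCochain (μ := μ) P (u' + v'), coeFn_kernelCochain (μ := μ) P u',
      coeFn_kernelCochain (μ := μ) P v',
      AEEqFun.coeFn_add (kernelCochain P u' : Cochain μ m) (kernelCochain P v'),
      hP.ae_ae (AEEqFun.coeFn_add u' v'), hP.ae_integrable φ u.2, hP.ae_integrable φ v.2]
      with Δ h1 h2 h3 h4 h5 h6 h7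
    rw [h1, h4, Pi.add_apply, h2, h3, integral_congr_ae h5]
    exact integral_add h6 h7
  map_smul' c u := Subtype.ext (kernelCochain_smul P hP c _)

theorem coeFn_kernelOp (u : AS φ ν n) : AS.toCochain φ μ m (kernelOp φ P hP u)
    =ᵐ[simplexMeasure μ m] fun Δ => ∫ Δ', AS.toCochain φ ν n u Δ' ∂P Δ :=
  coeFn_kernelCochain P _

theorem continuous_kernelOp : Continuous (kernelOp φ P hP) :=
  continuous_of_modular_le φ _ fun s hs => by
    obtain ⟨C, t, hC, ht, h⟩ := modular_kernelCochain_le φ P hP hs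
    exact ⟨C, t, hC, ht, fun u => h _⟩

end KernelOperators

theorem coeFn_sum_smul {A ι : Type*} [MeasurableSpace A] (P : Measure A) (s : Finset ι)
    (c : ι → ℝ) (v : ι → A →ₘ[P] ℝ) :
    (∑ i ∈ s, c i • v i : A →ₘ[P] ℝ) =ᵐ[P] fun a => ∑ i ∈ s, c i * v i a := by
  classical
  induction s using Finset.induction_on with
  | empty => simp only [Finset.sum_empty]; exact AEEqFun.coeFn_zero
  | insert i s hi ih =>
    rw [Finset.sum_insert hi]
    filter_upwards [AEEqFun.coeFn_add (c i • v i) (∑ i ∈ s, c i • v i),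
      AEEqFun.coeFn_smul (c i) (v i), ih] with a h1 h2 h3
    rw [h1, Pi.add_apply, h2, Pi.smul_apply, h3, Finset.sum_insert hi, smul_eq_mul]

/-! ### The coboundary as a sum of face operators, and its continuity. -/

section Coboundary

variable {X : Type*} [MetricSpace X] [MeasurableSpace X] [BorelSpace X] (φ : YoungFunction)
  (μ : Measure X) [BoundedGeometry μ]

theorem coeFn_faceComp (k : ℕ) (i : Fin (k + 2)) (u : Cochain μ k) :
    faceComp μ k i u =ᵐ[simplexMeasure μ (k + 1)] fun Δ => u (face i Δ) :=
  AEEqFun.coeFn_compQuasiMeasurePreserving u (quasiMeasurePreserving_face μ k i)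

theorem coeFn_coboundary (k : ℕ) (u : AS φ μ k) :
    AS.toCochain φ μ (k + 1) (coboundary φ μ k u) =ᵐ[simplexMeasure μ (k + 1)]
      fun Δ => ∑ i : Fin (k + 2), (-1 : ℝ) ^ (i : ℕ) * AS.toCochain φ μ k u (face i Δ) := by
  have e : AS.toCochain φ μ (k + 1) (coboundary φ μ k u) =
      ∑ i : Fin (k + 2), (-1 : ℝ) ^ (i : ℕ) • faceComp μ k i (AS.toCochain φ μ k u) := by
    change cochainD μ k (AS.toCochain φ μ k u) = _
    rw [cochainD, LinearMap.sum_apply]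
    rfl
  rw [e]
  filter_upwards [coeFn_sum_smul (simplexMeasure μ (k + 1)) Finset.univ
    (fun i : Fin (k + 2) => (-1 : ℝ) ^ (i : ℕ)) fun i => faceComp μ k i (AS.toCochain φ μ k u),
    ae_all_iff.2 fun i => coeFn_faceComp μ k i (AS.toCochain φ μ k u)] with Δ h1 h2
  rw [h1]
  exact Finset.sum_congr rfl fun i _ => by rw [h2 i]

/-- The operator `u ↦ u ∘ ∂ᵢ` on `AS_φ^k(X)`. -/
def faceOp (k : ℕ) (i : Fin (k + 2)) : AS φ μ k →ₗ[ℝ] AS φ μ (k + 1) :=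
  (faceComp μ k i).restrict fun _ hu => faceComp_mem φ μ k i hu

theorem continuous_faceOp (k : ℕ) (i : Fin (k + 2)) : Continuous (faceOp φ μ k i) :=
  continuous_of_modular_le φ _ fun s hs => by
    obtain ⟨C, hC, h⟩ := exists_lintegral_face_le μ k i s
    refine ⟨C, s, hC, hs, fun u => ?_⟩
    rw [modular_congr φ μ s (AS.toCochain φ μ (k + 1) (faceOp φ μ k i u))
      (coeFn_faceComp μ k i (AS.toCochain φ μ k u))]
    exact h _ (φ.measurable_ofReal_comp (AEEqFun.measurable _))

theorem coboundary_eq_sum (k : ℕ) :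
    coboundary φ μ k = ∑ i : Fin (k + 2), (-1 : ℝ) ^ (i : ℕ) • faceOp φ μ k i := by
  ext u
  refine Subtype.ext ?_
  change cochainD μ k (AS.toCochain φ μ k u) = AS.toCochain φ μ (k + 1) _
  rw [cochainD, LinearMap.sum_apply, LinearMap.sum_apply, map_sum]
  rfl

theorem continuous_coboundary (k : ℕ) : Continuous (coboundary φ μ k) := by
  rw [coboundary_eq_sum]
  have e : ⇑(∑ i : Fin (k + 2), (-1 : ℝ) ^ (i : ℕ) • faceOp φ μ k i) =
      fun u => ∑ i : Fin (k + 2), (-1 : ℝ) ^ (i : ℕ) • faceOp φ μ k i u := by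
    ext u
    rw [LinearMap.sum_apply]
    rfl
  rw [e]
  exact continuous_finsetSum _ fun i _ =>
    (continuous_faceOp φ μ k i).const_smul ((-1 : ℝ) ^ (i : ℕ))

end Coboundary

/-! ### Combinatorics of the prism homotopy. -/

section Prism

/-- Isolates the faces `i` and `i + 1`, which telescope in the prism sum, and shifts the later faces
down by one so that they can cancel. -/
theorem sum_range_eq_sum_of_le {i K : ℕ} (hi : i ≤ K) (f : ℕ → ℝ) :
    ∑ j ∈ Finset.range (K + 2), f j = ∑ j ∈ Finset.range (K + 1),
      ((if j < i then f j else 0) + (if i < j then f (j + 1) else 0)) + f i + f (i + 1) := by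
  induction K, hi using Nat.le_induction with
  | base =>
    rw [Finset.sum_range_succ, Finset.sum_range_succ, Finset.sum_range_succ]
    have : ∑ j ∈ Finset.range i, f j = ∑ j ∈ Finset.range i,
      ((if j < i then f j else 0) + (if i < j then f (j + 1) else 0)) := by
      refine Finset.sum_congr rfl fun j hj => ?_
      have := Finset.mem_range.1 hj
      simp [this, this.le]
    rw [this]
    simp
  | succ K hK ih =>
    rw [Finset.sum_range_succ, ih, Finset.sum_range_succ _ (K + 1)]
    have h1 : ¬ K + 1 < i := by omega
    have h2 : i < K + 1 := by omega
    simp only [if_neg h1, if_pos h2]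
    ring

/-- The cancellations behind the prism operator. -/
theorem sum_prism_faces (K : ℕ) (a b : ℕ → ℕ → ℝ)
    (h₁ : ∀ i j, j ≤ i → i < K → a (i + 1) j = b i j)
    (h₂ : ∀ i j, i < j → j ≤ K → a i (j + 1) = b i j)
    (h₃ : ∀ i < K, a i (i + 1) = a (i + 1) (i + 1)) :
    ∑ i ∈ Finset.range (K + 1), ∑ j ∈ Finset.range (K + 2), (-1) ^ (i + j) * a i j +
      ∑ i ∈ Finset.range K, ∑ j ∈ Finset.range (K + 1), (-1) ^ (i + j) * b i j =
      a 0 0 - a K (K + 1) := by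
  -- Here `a i j` stands for the `j`-th face of the `i`-th prism simplex and `b i j` for the `i`-th
  -- prism simplex over the `j`-th face. Away from the faces `i` and `i + 1`, an index shift by one
  -- turns `a` into `b` with the opposite sign (`e₃`, `e₄`); the remaining two faces telescope
  -- (`e₂`).
  have e₁ : ∑ i ∈ Finset.range (K + 1), ∑ j ∈ Finset.range (K + 2), (-1) ^ (i + j) * a i j =
      ∑ i ∈ Finset.range (K + 1), ∑ j ∈ Finset.range (K + 1),
        (if j < i then (-1) ^ (i + j) * a i j else 0) +
      ∑ i ∈ Finset.range (K + 1), ∑ j ∈ Finset.range (K + 1),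
        (if i < j then (-1) ^ (i + (j + 1)) * a i (j + 1) else 0) +
      ∑ i ∈ Finset.range (K + 1), (a i i - a i (i + 1)) := by
    rw [← Finset.sum_add_distrib, ← Finset.sum_add_distrib]
    refine Finset.sum_congr rfl fun i hi => ?_
    rw [sum_range_eq_sum_of_le (Nat.lt_succ_iff.1 (Finset.mem_range.1 hi)),
      Finset.sum_add_distrib]
    have : ((-1 : ℝ)) ^ (i + i) = 1 := Even.neg_one_pow ⟨i, rfl⟩
    have h' : ((-1 : ℝ)) ^ (i + (i + 1)) = -1 := Odd.neg_one_pow ⟨i, by ring⟩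
    rw [this, h']
    ring
  have e₂ : ∑ i ∈ Finset.range (K + 1), (a i i - a i (i + 1)) = a 0 0 - a K (K + 1) := by
    have : ∑ i ∈ Finset.range K, (a i i - a i (i + 1)) =
        ∑ i ∈ Finset.range K, (a i i - a (i + 1) (i + 1)) :=
      Finset.sum_congr rfl fun i hi => by rw [h₃ i (Finset.mem_range.1 hi)]
    rw [Finset.sum_range_succ, this, Finset.sum_range_sub' (fun i => a i i)]
    ring
  have e₃ : ∑ i ∈ Finset.range (K + 1), ∑ j ∈ Finset.range (K + 1),
        (if j < i then (-1) ^ (i + j) * a i j else 0) = ∑ i ∈ Finset.range K,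
      ∑ j ∈ Finset.range (K + 1), (if j ≤ i then - ((-1) ^ (i + j) * b i j) else 0) := by
    rw [Finset.sum_range_succ']
    simp only [not_lt_zero, if_false, Finset.sum_const_zero, add_zero]
    refine Finset.sum_congr rfl fun i hi => Finset.sum_congr rfl fun j _ => ?_
    simp only [Nat.lt_succ_iff]
    split_ifs with hj
    · rw [h₁ i j hj (Finset.mem_range.1 hi)]; ring
    · rfl
  have e₄ : ∑ i ∈ Finset.range (K + 1), ∑ j ∈ Finset.range (K + 1),
        (if i < j then (-1) ^ (i + (j + 1)) * a i (j + 1) else 0) = ∑ i ∈ Finset.range K,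
      ∑ j ∈ Finset.range (K + 1), (if j ≤ i then 0 else - ((-1) ^ (i + j) * b i j)) := by
    rw [Finset.sum_range_succ, Finset.sum_eq_zero (s := Finset.range (K + 1))
      (f := fun j => if K < j then (-1) ^ (K + (j + 1)) * a K (j + 1) else 0), add_zero]
    · refine Finset.sum_congr rfl fun i hi => Finset.sum_congr rfl fun j hj => ?_
      by_cases h : j ≤ i
      · rw [if_pos h, if_neg (not_lt.2 h)]
      · rw [if_neg h, if_pos (not_le.1 h), h₂ i j (not_le.1 h)
          (Nat.lt_succ_iff.1 (Finset.mem_range.1 hj))]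
        ring
    · intro j hj
      have := Finset.mem_range.1 hj
      rw [if_neg (by omega)]
  rw [e₁, e₂, e₃, e₄, ← Finset.sum_add_distrib, add_right_comm, ← Finset.sum_add_distrib,
    Finset.sum_eq_zero, zero_add]
  intro i _
  rw [← Finset.sum_add_distrib, ← Finset.sum_add_distrib]
  refine Finset.sum_eq_zero fun j _ => ?_
  split_ifs <;> ring

variable {X : Type*}

/-- Written with natural indices, so that the simplicial identities become case distinctions. The
truncated `l - 1` is harmless: that branch has `l > i`. -/
theorem prism_apply {k : ℕ} (i : Fin (k + 1)) (z : Fin (k + 1) → X × X) (l : Fin (k + 2)) :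
    prism i z l = if h : l.val ≤ i.val then (z ⟨l, by omega⟩).1 else
      (z ⟨l - 1, by omega⟩).2 := by
  unfold prism
  by_cases h : l.val ≤ i.val
  · have h' : l ≤ i.castSucc := h
    rw [if_pos h', dif_pos h]
    congr 2
    ext
    simp [Fin.predAbove, not_lt.2 h']
  · have h' : i.castSucc < l := not_le.1 h
    rw [if_neg (not_le.2 h'), dif_neg h]
    congr 2
    ext
    simp [Fin.predAbove, h']

theorem face_apply {k : ℕ} (j : Fin (k + 2)) (Δ : Fin (k + 2) → X) (l : Fin (k + 1)) :
    face j Δ l = Δ ⟨if l.val < j.val then l else l + 1, by split_ifs <;> omega⟩ := by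
  unfold face
  congr 1
  ext
  simp only [Fin.succAbove, Fin.lt_def, Fin.val_castSucc]
  split_ifs <;> rfl

/-- Deleting `xⱼ` from the initial part shortens that part, so the prism index drops by one. -/
theorem face_prism_of_le {k : ℕ} (z : Fin (k + 2) → X × X) (i : Fin (k + 1)) (j : Fin (k + 2))
    (h : j.val ≤ i.val) : face j.castSucc (prism i.succ z) = prism i (face j z) := by
  ext l
  simp only [face_apply, prism_apply, Fin.val_castSucc, Fin.val_succ]
  have := l.2
  grind

/-- Vertex `j + 1` is `yⱼ`; deleting it leaves the initial part, hence the prism index, unchanged.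
-/
theorem face_prism_of_lt {k : ℕ} (z : Fin (k + 2) → X × X) (i : Fin (k + 1)) (j : Fin (k + 2))
    (h : i.val < j.val) : face j.succ (prism i.castSucc z) = prism i (face j z) := by
  ext l
  simp only [face_apply, prism_apply, Fin.val_castSucc, Fin.val_succ]
  have := l.2
  grind

/-- Both sides are `(x₀, …, xᵢ, y_{i+1}, …)`: the left one has lost `yᵢ`, the right one `x_{i+1}`.
-/
theorem face_prism_middle {k : ℕ} (z : Fin (k + 2) → X × X) (i : Fin (k + 1)) :
    face i.succ.castSucc (prism i.castSucc z) = face i.succ.castSucc (prism i.succ z) := by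
  ext l
  simp only [face_apply, prism_apply, Fin.val_castSucc, Fin.val_succ]
  have := l.2
  grind

theorem face_zero_prism_zero {k : ℕ} (z : Fin (k + 1) → X × X) :
    face 0 (prism 0 z) = fun l => (z l).2 := by
  ext l
  simp [face_apply, prism_apply]

theorem face_last_prism_last {k : ℕ} (z : Fin (k + 1) → X × X) :
    face (Fin.last (k + 1)) (prism (Fin.last k) z) = fun l => (z l).1 := by
  ext l
  have := l.2
  simp only [face_apply, prism_apply, Fin.val_last]
  split_ifs <;> first | rfl | omega

/-- The prism operator is a chain homotopy, in positive degree. -/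
theorem prism_homotopy {k : ℕ} (u : (Fin (k + 2) → X) → ℝ) (z : Fin (k + 2) → X × X) :
    ∑ i : Fin (k + 2), ∑ j : Fin (k + 3), (-1) ^ (i.val + j.val) * u (face j (prism i z)) +
      ∑ i : Fin (k + 1), ∑ j : Fin (k + 2), (-1) ^ (i.val + j.val) * u (prism i (face j z)) =
      u (fun l => (z l).2) - u (fun l => (z l).1) := by
  -- Extension by zero to all naturals, in order to apply `sum_prism_faces` with `K = k + 1`.
  let a : ℕ → ℕ → ℝ := fun i j => if h : i < k + 2 ∧ j < k + 3 then
    u (face ⟨j, h.2⟩ (prism ⟨i, h.1⟩ z)) else 0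
  let b : ℕ → ℕ → ℝ := fun i j => if h : i < k + 1 ∧ j < k + 2 then
    u (prism ⟨i, h.1⟩ (face ⟨j, h.2⟩ z)) else 0
  have key := sum_prism_faces (k + 1) a b (fun i j hj hi => ?_) (fun i j hi hj => ?_)
    (fun i hi => ?_)
  · simp only [Finset.sum_range] at key
    have ea : ∀ (i : Fin (k + 2)) (j : Fin (k + 3)), a i j = u (face j (prism i z)) := fun i j =>
      dif_pos ⟨i.2, j.2⟩
    have eb : ∀ (i : Fin (k + 1)) (j : Fin (k + 2)), b i j = u (prism i (face j z)) := fun i j =>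
      dif_pos ⟨i.2, j.2⟩
    simp only [ea, eb] at key
    refine key.trans ?_
    have h0 := ea 0 0
    have h1 := ea (Fin.last _) (Fin.last _)
    rw [face_zero_prism_zero] at h0
    rw [face_last_prism_last] at h1
    exact congrArg₂ _ h0 h1
  · have := face_prism_of_le z ⟨i, hi⟩ ⟨j, by omega⟩ hj
    simp only [a, b]
    rw [dif_pos ⟨by omega, by omega⟩, dif_pos ⟨by omega, by omega⟩]
    exact congrArg u this
  · have := face_prism_of_lt z ⟨i, by omega⟩ ⟨j, by omega⟩ hi
    simp only [a, b]
    rw [dif_pos ⟨by omega, by omega⟩, dif_pos ⟨by omega, by omega⟩]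
    exact congrArg u this
  · have := face_prism_middle z ⟨i, by omega⟩
    simp only [a]
    rw [dif_pos ⟨by omega, by omega⟩, dif_pos ⟨by omega, by omega⟩]
    exact congrArg u this

/-- The prism operator is a chain homotopy, in degree zero. -/
theorem prism_homotopy_zero (u : (Fin 1 → X) → ℝ) (z : Fin 1 → X × X) :
    ∑ i : Fin 1, ∑ j : Fin 2, (-1) ^ (i.val + j.val) * u (face j (prism i z)) =
      u (fun l => (z l).2) - u (fun l => (z l).1) := by
  have h0 := face_zero_prism_zero z
  have h1 := face_last_prism_last z
  rw [Fin.sum_univ_one, Fin.sum_univ_two, h0]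
  change _ + _ * u (face (Fin.last 1) (prism (Fin.last 0) z)) = _
  rw [h1]
  simp
  ring

end Prism

/-! ### Commutation with the coboundary, and the homotopy to the identity. -/

section Homotopy

open ProbabilityTheory

theorem piKernel_map_comp {X Y Z : Type*} [MeasurableSpace X] [MeasurableSpace Y]
    [MeasurableSpace Z] (κ : Kernel X Y) [IsMarkovKernel κ] {f : Y → Z} (hf : Measurable f)
    (n : ℕ) (x : Fin n → X) :
    (piKernel κ n x).map (fun y l => f (y l)) = Measure.pi fun l => (κ (x l)).map f := by
  rw [piKernel_apply]
  exact (Measure.pi_map_pi fun _ => hf.aemeasurable)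

theorem pi_dirac_eq {X : Type*} [MeasurableSpace X] {n : ℕ} (x : Fin n → X) :
    (Measure.pi fun l => Measure.dirac (x l)) = Measure.dirac x := by
  refine Measure.pi_eq fun s hs => ?_
  rw [Measure.dirac_apply' _ (MeasurableSet.univ_pi hs)]
  simp only [Measure.dirac_apply' _ (hs _)]
  by_cases h : x ∈ univ.pi s
  · rw [indicator_of_mem h, Pi.one_apply, Finset.prod_eq_one]
    intro i _
    rw [indicator_of_mem (h i (mem_univ i)), Pi.one_apply]
  · rw [indicator_of_notMem h]
    obtain ⟨i, hi⟩ := not_forall.1 (fun h' => h (mem_univ_pi.2 h'))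
    exact (Finset.prod_eq_zero (Finset.mem_univ i) (indicator_of_notMem hi _)).symm

theorem measurable_face {X : Type*} [MeasurableSpace X] {k : ℕ} (i : Fin (k + 2)) :
    Measurable (face (X := X) i) :=
  measurable_pi_lambda _ fun _ => measurable_pi_apply _

variable {X Y : Type*} [MetricSpace X] [MeasurableSpace X] [BorelSpace X]
  [MetricSpace Y] [MeasurableSpace Y] [BorelSpace Y]
  (φ : YoungFunction) (μ : Measure X) (ν : Measure Y) [BoundedGeometry μ] [BoundedGeometry ν]

theorem integrable_comp_iff {A B : Type*} [MeasurableSpace A] [MeasurableSpace B] {P : Measure A}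
    {g : A → B} (hg : Measurable g) {f : B → ℝ} (hf : Measurable f) :
    Integrable (fun a => f (g a)) P ↔ Integrable f (P.map g) :=
  (integrable_map_measure hf.aestronglyMeasurable hg.aemeasurable).symm

theorem integral_comp_eq {A B : Type*} [MeasurableSpace A] [MeasurableSpace B] {P : Measure A}
    {g : A → B} (hg : Measurable g) {f : B → ℝ} (hf : Measurable f) :
    ∫ a, f (g a) ∂P = ∫ b, f b ∂(P.map g) :=
  (integral_map hg.aemeasurable hf.aestronglyMeasurable).symm

/-- The operators given by product kernels commute with the coboundary operators. -/
theorem coboundary_kernelOp_piKernel (κ : Kernel X Y) [IsMarkovKernel κ]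
    (hκ : ∀ k : ℕ, ControlledKernel μ ν (piKernel κ (k + 1))) (k : ℕ) (u : AS φ ν k) :
    coboundary φ μ k (kernelOp φ _ (hκ k) u) =
      kernelOp φ _ (hκ (k + 1)) (coboundary φ ν k u) := by
  refine Subtype.ext (AEEqFun.ext ?_)
  -- Properties of almost every `k`-simplex hold for all faces of almost every `(k + 1)`-simplex.
  have hface := fun i => (quasiMeasurePreserving_face μ k i).ae ((hκ k).ae_integrable φ u.2)
  have hop := fun i => (quasiMeasurePreserving_face μ k i).ae
    (coeFn_kernelOp φ _ (hκ k) u)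
  filter_upwards [coeFn_coboundary φ μ k (kernelOp φ _ (hκ k) u),
    coeFn_kernelOp φ _ (hκ (k + 1)) (coboundary φ ν k u),
    (hκ (k + 1)).ae_ae (coeFn_coboundary φ ν k u), ae_all_iff.2 hface, ae_all_iff.2 hop]
    with Δ h1 h2 h3 h4 h5
  refine h1.trans (Eq.trans ?_ h2.symm)
  have hm : Measurable (AS.toCochain φ ν k u) := AEEqFun.measurable _
  rw [integral_congr_ae h3, integral_finsetSum]
  · refine Finset.sum_congr rfl fun i _ => ?_
    rw [integral_const_mul, integral_comp_eq (measurable_face i) hm, piKernel_map_face, h5 i]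
  · intro i _
    refine Integrable.const_mul ?_ _
    rw [integrable_comp_iff (measurable_face i) hm, piKernel_map_face]
    exact h4 i

variable {μ}

/-- A product kernel acts trivially on cohomology. -/
theorem kernelOp_piKernel_sub_mem_coboundaries (κ : Kernel X X) [IsMarkovKernel κ]
    (hκ : ∀ k : ℕ, ControlledKernel μ μ (piKernel κ (k + 1)))
    (hp : ∀ (k : ℕ) (i : Fin (k + 1)), ControlledKernel μ μ (prismKernel κ i)) {k : ℕ}
    {u : AS φ μ k} (hu : coboundary φ μ k u = 0) :
    kernelOp φ _ (hκ k) u - u ∈ coboundaries φ μ k := by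
  -- `K Δ` is the law of the pairs `(xⱼ, yⱼ)`. Its first marginal is the Dirac mass at `Δ` and its
  -- second is `piKernel κ`, so integrating the prism identity against it yields `kernelOp u - u`.
  set K := piKernel (graphKernel κ) (k + 1) with hK
  set v := AS.toCochain φ μ k u with hv
  have hm : Measurable v := AEEqFun.measurable _
  have hd : ∀ᵐ Δ ∂simplexMeasure μ (k + 1),
      ∑ i : Fin (k + 2), (-1 : ℝ) ^ (i : ℕ) * v (face i Δ) = 0 := by
    filter_upwards [coeFn_coboundary φ μ k u, AEEqFun.coeFn_zero (μ := simplexMeasure μ (k + 1))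
      (β := ℝ)] with Δ h1 h2
    rw [← h1, hu, map_zero, h2, Pi.zero_apply]
  -- The cocycle identity holds only almost everywhere. Control of the prism kernels is what permits
  -- evaluating it on prism simplices.
  have hd' : ∀ᵐ Δ ∂simplexMeasure μ k, ∀ᵐ z ∂K Δ, ∀ i : Fin (k + 1),
      ∑ j : Fin (k + 2), (-1 : ℝ) ^ (j : ℕ) * v (face j (prism i z)) = 0 := by
    have := ae_all_iff.2 fun i : Fin (k + 1) => (hp k i).ae_ae hd
    filter_upwards [this] with Δ h
    refine ae_all_iff.2 fun i => ?_
    have h := h i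
    rw [prismKernel, Kernel.map_apply _ (measurable_prism i)] at h
    exact ae_of_ae_map (measurable_prism i).aemeasurable h
  have hd'' : ∀ᵐ Δ ∂simplexMeasure μ k, ∀ᵐ z ∂K Δ, ∑ i : Fin (k + 1), ∑ j : Fin (k + 2),
      (-1 : ℝ) ^ (i.val + j.val) * v (face j (prism i z)) = 0 := by
    filter_upwards [hd'] with Δ h
    filter_upwards [h] with z h
    refine Finset.sum_eq_zero fun i _ => ?_
    simp only [pow_add, mul_assoc]
    rw [← Finset.mul_sum, h i, mul_zero]
  have msnd : Measurable fun (z : Fin (k + 1) → X × X) l => (z l).2 :=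
    measurable_pi_lambda _ fun l => measurable_snd.comp (measurable_pi_apply l)
  have mfst : Measurable fun (z : Fin (k + 1) → X × X) l => (z l).1 :=
    measurable_pi_lambda _ fun l => measurable_fst.comp (measurable_pi_apply l)
  have esnd : ∀ Δ, (K Δ).map (fun z l => (z l).2) = piKernel κ (k + 1) Δ := fun Δ => by
    rw [piKernel_map_comp _ measurable_snd]
    simp only [graphKernel_map_snd]
    rfl
  have efst : ∀ Δ, (K Δ).map (fun z l => (z l).1) = Measure.dirac Δ := fun Δ => by
    rw [piKernel_map_comp _ measurable_fst]
    simp only [graphKernel_map_fst, pi_dirac_eq]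
  have isnd := (hκ k).ae_integrable φ u.2
  have ifst : ∀ Δ, Integrable v (Measure.dirac Δ) := fun Δ =>
    integrable_dirac' hm.stronglyMeasurable enorm_lt_top
  have hdiff : ∀ᵐ Δ ∂simplexMeasure μ k,
      ∫ z, (v (fun l => (z l).2) - v (fun l => (z l).1)) ∂K Δ =
        AS.toCochain φ μ k (kernelOp φ _ (hκ k) u - u) Δ := by
    rw [map_sub]
    filter_upwards [isnd, coeFn_kernelOp φ _ (hκ k) u,
      AEEqFun.coeFn_sub (AS.toCochain φ μ k (kernelOp φ _ (hκ k) u)) v] with Δ h1 h2 h3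
    rw [h3, Pi.sub_apply, h2, integral_sub, integral_comp_eq msnd hm, integral_comp_eq mfst hm,
      esnd, efst, integral_dirac' _ _ hm.stronglyMeasurable]
    · rw [integrable_comp_iff msnd hm, esnd]; exact h1
    · rw [integrable_comp_iff mfst hm, efst]; exact ifst Δ
  obtain _ | k := k
  -- In degree zero the coboundaries are `⊥`, so the difference itself has to vanish.
  · change _ = _
    refine Subtype.ext (AEEqFun.ext ?_)
    filter_upwards [hdiff, hd'', AEEqFun.coeFn_zero (μ := simplexMeasure μ 0) (β := ℝ)]
      with Δ h1 h2 h3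
    refine h1.symm.trans (Eq.trans ?_ h3.symm)
    refine integral_eq_zero_of_ae ?_
    filter_upwards [h2] with z h2
    rw [← prism_homotopy_zero, h2]
    rfl
  -- The primitive is the alternating sum of the prism operators.
  · refine ⟨∑ i : Fin (k + 1), (-1 : ℝ) ^ (i : ℕ) • kernelOp φ _ (hp k i) u, ?_⟩
    refine Subtype.ext (AEEqFun.ext ?_)
    set w := ∑ i : Fin (k + 1), (-1 : ℝ) ^ (i : ℕ) • kernelOp φ _ (hp k i) u with hw
    have hwc : AS.toCochain φ μ k w =ᵐ[simplexMeasure μ k] fun Δ =>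
        ∑ i : Fin (k + 1), (-1 : ℝ) ^ (i : ℕ) * ∫ Δ', v Δ' ∂prismKernel κ i Δ := by
      rw [hw, map_sum]
      simp only [map_smul]
      filter_upwards [coeFn_sum_smul (simplexMeasure μ k) Finset.univ
        (fun i : Fin (k + 1) => (-1 : ℝ) ^ (i : ℕ))
        fun i => AS.toCochain φ μ k (kernelOp φ _ (hp k i) u),
        ae_all_iff.2 fun i => coeFn_kernelOp φ _ (hp k i) u] with Δ h1 h2
      rw [h1]
      exact Finset.sum_congr rfl fun i _ => by rw [h2 i]
    have hint := ae_all_iff.2 fun i : Fin (k + 1) => (hp k i).ae_integrable φ u.2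
    filter_upwards [hdiff, hd'', coeFn_coboundary φ μ k w,
      ae_all_iff.2 fun j => (quasiMeasurePreserving_face μ k j).ae hwc,
      ae_all_iff.2 fun j => (quasiMeasurePreserving_face μ k j).ae hint] with Δ h1 h2 h3 h4 h5
    refine h3.trans (Eq.trans ?_ h1)
    have mpf : ∀ (i : Fin (k + 1)) (j : Fin (k + 2)), Measurable fun z : Fin (k + 2) → X × X =>
        prism i (face j z) := fun i j => (measurable_prism i).comp (measurable_face j)
    -- A prism over the `j`-th face sees only the marginal of `K Δ` on that face.
    have emap : ∀ (i : Fin (k + 1)) (j : Fin (k + 2)),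
        (K Δ).map (fun z => prism i (face j z)) = prismKernel κ i (face j Δ) := fun i j => by
      rw [prismKernel, Kernel.map_apply _ (measurable_prism i), ← piKernel_map_face,
        Measure.map_map (measurable_prism i) (measurable_face j)]
      rfl
    have hi : ∀ (i : Fin (k + 1)) (j : Fin (k + 2)),
        Integrable (fun z => (-1 : ℝ) ^ (i.val + j.val) * v (prism i (face j z))) (K Δ) := by
      intro i j
      refine Integrable.const_mul ?_ _
      rw [integrable_comp_iff (mpf i j) hm, emap]
      exact h5 j i
    have : ∫ z, (v (fun l => (z l).2) - v (fun l => (z l).1)) ∂K Δ =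
        ∫ z, ∑ i : Fin (k + 1), ∑ j : Fin (k + 2),
          (-1 : ℝ) ^ (i.val + j.val) * v (prism i (face j z)) ∂K Δ := by
      refine integral_congr_ae ?_
      filter_upwards [h2] with z h2
      rw [← prism_homotopy, h2, zero_add]
    rw [this, integral_finsetSum _ fun i _ => integrable_finsetSum _ fun j _ => hi i j,
      Finset.sum_congr rfl fun i _ => integral_finsetSum _ fun j _ => hi i j, Finset.sum_comm]
    refine Finset.sum_congr rfl fun j _ => ?_
    rw [h4 j, Finset.mul_sum]
    refine Finset.sum_congr rfl fun i _ => ?_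
    rw [integral_const_mul, integral_comp_eq (mpf i j) hm, emap]
    ring

end Homotopy

/-! ### `AS_φ^k(X)` is a Fréchet space -/

section Frechet

variable {X : Type*} [MetricSpace X] [MeasurableSpace X] (φ : YoungFunction) (μ : Measure X)

theorem modular_mono {k : ℕ} {s t : ℝ} (h : s ≤ t) (u : Cochain μ k) :
    modular φ μ s u ≤ modular φ μ t u := lintegral_mono_set (smallSimplices_mono h)

/-- The strict inequality yields an admissible `α < ε`, so it does not matter whether the infimum is
attained. -/
theorem modular_inv_smul_le_of_luxemburg_lt {k : ℕ} {s : Ioi (0 : ℝ)} {u : AS φ μ k} {ε : ℝ}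
    (h : luxemburg φ μ k s u < ε) : modular φ μ s (ε⁻¹ • AS.toCochain φ μ k u) ≤ 1 := by
  rw [luxemburg_apply] at h
  obtain ⟨α, ⟨hα, hu⟩, hlt⟩ := exists_lt_of_csInf_lt (u.2 s s.2) h
  have hε : 0 < ε := hα.trans hlt
  have e : ε⁻¹ • AS.toCochain φ μ k u = (α / ε) • (α⁻¹ • AS.toCochain φ μ k u) := by
    rw [smul_smul]
    congr 1
    field_simp
  rw [e]
  refine (modular_smul_le φ μ s ?_ _).trans hu
  rw [abs_of_pos (by positivity), div_le_one hε]
  exact hlt.le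

theorem luxemburg_le {k : ℕ} {s : Ioi (0 : ℝ)} {u : AS φ μ k} {ε : ℝ} (hε : 0 < ε)
    (h : modular φ μ s (ε⁻¹ • AS.toCochain φ μ k u) ≤ 1) : luxemburg φ μ k s u ≤ ε := by
  rw [luxemburg_apply]
  exact csInf_le ⟨0, fun _ h => h.1.le⟩ ⟨hε, h⟩

theorem luxemburg_mono {k : ℕ} {s t : Ioi (0 : ℝ)} (h : s ≤ t) (u : AS φ μ k) :
    luxemburg φ μ k s u ≤ luxemburg φ μ k t u := by
  refine le_of_forall_gt_imp_ge_of_dense fun ε hε => ?_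
  exact luxemburg_le φ μ ((apply_nonneg _ _).trans_lt hε)
    ((modular_mono φ μ h _).trans (modular_inv_smul_le_of_luxemburg_lt φ μ hε))

/-- The semi-norms with a positive integral parameter induce the topology. -/
theorem withSeminorms_luxemburg_nat (k : ℕ) : WithSeminorms fun n : ℕ =>
    luxemburg φ μ k ⟨(n : ℝ) + 1, by simp only [mem_Ioi]; positivity⟩ := by
  refine (withSeminorms_luxemburg φ μ k).congr (fun n => ?_) fun s => ?_
  · refine ⟨{⟨(n : ℝ) + 1, by simp only [mem_Ioi]; positivity⟩}, 1, ?_⟩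
    rw [Finset.sup_singleton, one_smul]
    exact le_rfl
  · obtain ⟨n, hn⟩ := exists_nat_ge (s : ℝ)
    refine ⟨{n}, 1, ?_⟩
    rw [Finset.sup_singleton, one_smul]
    exact fun u => luxemburg_mono φ μ (show (s : ℝ) ≤ n + 1 by linarith) u

instance (k : ℕ) : FirstCountableTopology (AS φ μ k) :=
  (withSeminorms_luxemburg_nat φ μ k).firstCountableTopology

instance (k : ℕ) : LocallyConvexSpace ℝ (AS φ μ k) :=
  (withSeminorms_luxemburg φ μ k).toLocallyConvexSpace

/-- On sets of finite measure consisting of small simplices, the modular controls the `L¹` norm. -/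
theorem eLpNorm_one_le_of_modular_le {k : ℕ} {G : Set (Fin (k + 1) → X)} {s : ℝ}
    (hG : G ⊆ smallSimplices X k s) {u : Cochain μ k} {ε : ℝ} (hε : 0 < ε)
    (h : modular φ μ s (ε⁻¹ • u) ≤ 1) :
    eLpNorm u 1 ((simplexMeasure μ k).restrict G) ≤
      ENNReal.ofReal ε * (simplexMeasure μ k G + ENNReal.ofReal (φ 1)⁻¹) := by
  have h1 := φ.map_one_pos
  have hm : Measurable fun Δ => ENNReal.ofReal (φ (ε⁻¹ * u Δ)) :=
    φ.measurable_ofReal_comp (u.measurable.const_mul _)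
  rw [eLpNorm_one_eq_lintegral_enorm]
  calc ∫⁻ Δ in G, ‖u Δ‖ₑ ∂simplexMeasure μ k
      ≤ ∫⁻ Δ in G, ENNReal.ofReal ε *
          (1 + ENNReal.ofReal (φ 1)⁻¹ * ENNReal.ofReal (φ (ε⁻¹ * u Δ))) ∂simplexMeasure μ k := by
        refine lintegral_mono fun Δ => ?_
        rw [← ENNReal.ofReal_mul (by positivity), ← ENNReal.ofReal_one,
          ← ENNReal.ofReal_add zero_le_one (mul_nonneg (by positivity) (φ.nonneg' _)),
          ← ENNReal.ofReal_mul hε.le, Real.enorm_eq_ofReal_abs]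
        refine ENNReal.ofReal_le_ofReal ?_
        -- The linear growth bound `|t| ≤ 1 + φ t / φ 1` at `t = u / ε`.
        have := φ.abs_le (ε⁻¹ * u Δ)
        rw [abs_mul, abs_of_pos (inv_pos.2 hε), inv_mul_le_iff₀ hε] at this
        rwa [inv_mul_eq_div]
    _ = ENNReal.ofReal ε * (simplexMeasure μ k G + ENNReal.ofReal (φ 1)⁻¹ *
          ∫⁻ Δ in G, ENNReal.ofReal (φ (ε⁻¹ * u Δ)) ∂simplexMeasure μ k) := by
        rw [lintegral_const_mul' _ _ ENNReal.ofReal_ne_top, lintegral_add_left measurable_const,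
          lintegral_const_mul _ hm, setLIntegral_const, one_mul]
    _ ≤ ENNReal.ofReal ε * (simplexMeasure μ k G + ENNReal.ofReal (φ 1)⁻¹ * 1) := by
        gcongr
        refine (lintegral_mono_set hG).trans ?_
        rwa [← modular_smul]
    _ = _ := by rw [mul_one]

theorem ae_of_ae_iUnion {A : Type*} [MeasurableSpace A] {P : Measure A} {G : ℕ → Set A}
    (hG : ⋃ n, G n = univ) {p : A → Prop} (h : ∀ n, ∀ᵐ a ∂P.restrict (G n), p a) :
    ∀ᵐ a ∂P, p a := by
  rw [← Measure.restrict_univ (μ := P), ← hG, ae_restrict_iUnion_iff]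
  exact h

/-- Powers of concentric balls: finite measure gives `L¹` estimates, bounded diameter lets a single
semi-norm control each piece. -/
theorem exists_exhaustion [BorelSpace X] [BoundedGeometry μ] (k : ℕ) :
    ∃ G : ℕ → Set (Fin (k + 1) → X), (∀ n, simplexMeasure μ k (G n) < ∞) ∧
      (∀ n, ∃ s : ℝ, 0 < s ∧ G n ⊆ smallSimplices X k s) ∧ ⋃ n, G n = univ := by
  rcases isEmpty_or_nonempty X with h | ⟨⟨x⟩⟩
  · exact ⟨fun _ => ∅, fun _ => by simp, fun _ => ⟨1, one_pos, empty_subset _⟩,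
      Subsingleton.elim _ _⟩
  · refine ⟨fun n => univ.pi fun _ => Metric.ball x n, fun n => ?_, fun n => ?_, ?_⟩
    · rw [Measure.pi_pi]
      exact ENNReal.prod_lt_top fun _ _ => measure_ball_lt_top μ x n
    · refine ⟨2 * n + 1, by positivity, fun Δ hΔ => ?_⟩
      refine mem_smallSimplices_of_dist_le (by positivity) fun i j => ?_
      have h1 : dist (Δ i) x < n := hΔ i (mem_univ _)
      have h2 : dist (Δ j) x < n := hΔ j (mem_univ _)
      linarith [dist_triangle_right (Δ i) (Δ j) x]
    · refine eq_univ_of_forall fun Δ => ?_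
      obtain ⟨n, hn⟩ := exists_nat_gt (∑ i, dist (Δ i) x)
      refine mem_iUnion.2 ⟨n, fun i _ => lt_of_le_of_lt ?_ hn⟩
      exact Finset.single_le_sum (f := fun i => dist (Δ i) x) (fun _ _ => dist_nonneg)
        (Finset.mem_univ i)

/-- Fatou's lemma for the modular. -/
theorem modular_le_of_tendsto {k : ℕ} {s : ℝ} {w : ℕ → Cochain μ k} {v : Cochain μ k} {c : ℝ≥0∞}
    (hlim : ∀ᵐ Δ ∂simplexMeasure μ k, Filter.Tendsto (fun n => w n Δ) Filter.atTop (𝓝 (v Δ)))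
    (h : ∀ᶠ n in Filter.atTop, modular φ μ s (w n) ≤ c) : modular φ μ s v ≤ c := by
  have hm : ∀ n, Measurable fun Δ => ENNReal.ofReal (φ (w n Δ)) := fun n =>
    φ.measurable_ofReal_comp (AEEqFun.measurable _)
  calc modular φ μ s v = ∫⁻ Δ in smallSimplices X k s,
        Filter.liminf (fun n => ENNReal.ofReal (φ (w n Δ))) Filter.atTop ∂simplexMeasure μ k := by
        refine lintegral_congr_ae (ae_restrict_of_ae ?_)
        filter_upwards [hlim] with Δ hΔ
        have := ((ENNReal.continuous_ofReal.comp φ.continuous).tendsto (v Δ)).comp hΔ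
        exact this.liminf_eq.symm
    _ ≤ Filter.liminf (fun n => modular φ μ s (w n)) Filter.atTop := lintegral_liminf_le hm
    _ ≤ c := Filter.liminf_le_of_frequently_le' h.frequently

variable [BorelSpace X] [BoundedGeometry μ]

/-- If all semi-norms of `u` vanish, its `L¹` norm on each piece of the exhaustion is at most `ε *
M` for every `ε > 0`. -/
instance (k : ℕ) : T2Space (AS φ μ k) := by
  have : T1Space (AS φ μ k) := by
    refine (withSeminorms_luxemburg φ μ k).T1_of_separating fun u hu => ?_
    by_contra! h
    refine hu (Subtype.ext (AEEqFun.ext ?_))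
    change AS.toCochain φ μ k u =ᵐ[simplexMeasure μ k] (0 : Cochain μ k)
    refine Filter.EventuallyEq.trans ?_ AEEqFun.coeFn_zero.symm
    obtain ⟨G, hfin, hsub, hun⟩ := exists_exhaustion μ k
    refine ae_of_ae_iUnion hun fun n => ?_
    obtain ⟨s, hs, hG⟩ := hsub n
    set M := simplexMeasure μ k (G n) + ENNReal.ofReal (φ 1)⁻¹ with hM
    have hMt : M ≠ ∞ := ENNReal.add_ne_top.2 ⟨(hfin n).ne, ENNReal.ofReal_ne_top⟩
    have hle : ∀ ε : ℝ, 0 < ε → eLpNorm (AS.toCochain φ μ k u) 1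
        ((simplexMeasure μ k).restrict (G n)) ≤ ENNReal.ofReal ε * M := fun ε hε => by
      refine eLpNorm_one_le_of_modular_le φ μ hG hε ?_
      refine modular_inv_smul_le_of_luxemburg_lt φ μ (s := ⟨s, hs⟩) ?_
      rw [h]
      exact hε
    have h0 : eLpNorm (AS.toCochain φ μ k u) 1 ((simplexMeasure μ k).restrict (G n)) = 0 := by
      have hlim : Filter.Tendsto (fun ε : ℝ => ENNReal.ofReal ε * M) (𝓝[>] 0) (𝓝 0) := by
        have : Filter.Tendsto (fun ε : ℝ => ENNReal.ofReal ε * M) (𝓝 0)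
            (𝓝 (ENNReal.ofReal 0 * M)) :=
          ENNReal.Tendsto.mul_const (ENNReal.continuous_ofReal.tendsto 0) (Or.inr hMt)
        rw [ENNReal.ofReal_zero, zero_mul] at this
        exact this.mono_left nhdsWithin_le_nhds
      refine le_antisymm (ge_of_tendsto hlim ?_) zero_le
      filter_upwards [self_mem_nhdsWithin] with ε hε using hle ε hε
    exact (eLpNorm_eq_zero_iff (AEEqFun.measurable _).aestronglyMeasurable one_ne_zero).1 h0
  infer_instance

/-- On each piece of the exhaustion the sequence is Cauchy in `L¹` at a summable rate, hence
converges almost everywhere. Fatou's lemma then puts the limit in `AS_φ^k` and bounds its distance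
to the sequence. -/
theorem exists_tendsto_of_luxemburg_lt {k : ℕ} (u : ℕ → AS φ μ k)
    (hu : ∀ N m n : ℕ, N ≤ m → N ≤ n →
      luxemburg φ μ k ⟨(N : ℝ) + 1, by simp only [mem_Ioi]; positivity⟩ (u n - u m) <
        (1 / 2 : ℝ) ^ N) : ∃ v, Filter.Tendsto u Filter.atTop (𝓝 v) := by
  have hmod : ∀ (s : ℝ) (N : ℕ), s ≤ N + 1 → ∀ m n, N ≤ m → N ≤ n →
      modular φ μ s (((1 / 2 : ℝ) ^ N)⁻¹ • (AS.toCochain φ μ k (u n) -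
        AS.toCochain φ μ k (u m))) ≤ 1 := by
    intro s N hs m n hm hn
    refine (modular_mono φ μ hs _).trans ?_
    rw [← map_sub]
    exact modular_inv_smul_le_of_luxemburg_lt φ μ (hu N m n hm hn)
  have hae : ∀ᵐ Δ ∂simplexMeasure μ k, ∃ l,
      Filter.Tendsto (fun n => AS.toCochain φ μ k (u n) Δ) Filter.atTop (𝓝 l) := by
    obtain ⟨G, hfin, hsub, hun⟩ := exists_exhaustion μ k
    refine ae_of_ae_iUnion hun fun j => ?_
    obtain ⟨s, hs, hG⟩ := hsub j
    obtain ⟨N₀, hN₀⟩ := exists_nat_ge s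
    set M := simplexMeasure μ k (G j) + ENNReal.ofReal (φ 1)⁻¹ with hM
    have hMt : M ≠ ∞ := ENNReal.add_ne_top.2 ⟨(hfin j).ne, ENNReal.ofReal_ne_top⟩
    -- The shift by `N₀` makes the scale exceed `s` from the start; `M + 1` instead of `M` makes the
    -- bound strict.
    have key := Lp.ae_tendsto_of_cauchy_eLpNorm (μ := (simplexMeasure μ k).restrict (G j))
      (p := 1) (f := fun n => (AS.toCochain φ μ k (u (n + N₀)) : (Fin (k + 1) → X) → ℝ))
      (fun n => (AEEqFun.measurable _).aestronglyMeasurable) le_rfl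
      (B := fun N => (2⁻¹ : ℝ≥0∞) ^ N * (M + 1)) ?_ ?_
    · filter_upwards [key] with Δ ⟨l, hl⟩
      exact ⟨l, (Filter.tendsto_add_atTop_iff_nat N₀).1 hl⟩
    · rw [ENNReal.tsum_mul_right, ENNReal.tsum_geometric, ENNReal.one_sub_inv_two, inv_inv]
      exact ENNReal.mul_ne_top ENNReal.ofNat_ne_top (ENNReal.add_ne_top.2 ⟨hMt, ENNReal.one_ne_top⟩)
    · intro N n m hn hm
      have hε : (0 : ℝ) < (1 / 2 : ℝ) ^ (N + N₀) := by positivity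
      have := eLpNorm_one_le_of_modular_le φ μ hG hε
        (hmod s (N + N₀) (by push_cast; linarith [(Nat.cast_nonneg N : (0 : ℝ) ≤ N)])
          (m + N₀) (n + N₀) (by omega) (by omega))
      rw [eLpNorm_congr_ae (ae_restrict_of_ae (AEEqFun.coeFn_sub _ _))] at this
      refine this.trans_lt ?_
      have e : ENNReal.ofReal ((1 / 2 : ℝ) ^ (N + N₀)) ≤ (2⁻¹ : ℝ≥0∞) ^ N := by
        rw [ENNReal.ofReal_pow (by norm_num), one_div, ENNReal.ofReal_inv_of_pos two_pos,
          ENNReal.ofReal_ofNat]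
        exact pow_le_pow_right_of_le_one' (ENNReal.inv_le_one.2 one_le_two) (Nat.le_add_right _ _)
      refine (mul_le_mul_left e _).trans_lt ?_
      refine ENNReal.mul_lt_mul_right ?_ ?_ ?_
      · exact pow_ne_zero _ (ENNReal.inv_ne_zero.2 ENNReal.ofNat_ne_top)
      · exact ENNReal.pow_ne_top (ENNReal.inv_ne_top.2 two_ne_zero)
      · exact ENNReal.lt_add_right hMt one_ne_zero
  obtain ⟨f, hf, hlim⟩ := measurable_limit_of_tendsto_metrizable_ae
    (fun n => (AEEqFun.measurable (AS.toCochain φ μ k (u n))).aemeasurable) hae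
  set v : Cochain μ k := AEEqFun.mk f hf.aestronglyMeasurable with hv
  have hlim : ∀ᵐ Δ ∂simplexMeasure μ k,
      Filter.Tendsto (fun n => AS.toCochain φ μ k (u n) Δ) Filter.atTop (𝓝 (v Δ)) := by
    filter_upwards [hlim, AEEqFun.coeFn_mk f hf.aestronglyMeasurable] with Δ h1 h2
    rwa [hv, h2]
  have hvmem : v ∈ ASSubmodule φ μ k := by
    intro s hs
    obtain ⟨N, hN⟩ := exists_nat_ge s
    -- By the triangle inequality the later terms have semi-norm below that of `u N` plus `1`; the
    -- further `1` is slack.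
    set β := luxemburg φ μ k ⟨s, hs⟩ (u N) + 1 + 1 with hβ
    have hβ0 : 0 < β := by have := apply_nonneg (luxemburg φ μ k ⟨s, hs⟩) (u N); linarith
    refine ⟨β, hβ0, modular_le_of_tendsto φ μ (w := fun n => β⁻¹ • AS.toCochain φ μ k (u n)) ?_ ?_⟩
    · filter_upwards [hlim, AEEqFun.coeFn_smul β⁻¹ v,
        ae_all_iff.2 fun n => AEEqFun.coeFn_smul β⁻¹ (AS.toCochain φ μ k (u n))] with Δ h1 h2 h3
      simp only [h2, h3, Pi.smul_apply]
      exact h1.const_smul _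
    · filter_upwards [Filter.eventually_ge_atTop N] with n hn
      refine modular_inv_smul_le_of_luxemburg_lt φ μ (s := ⟨s, hs⟩) ?_
      have h1 := map_add_le_add (luxemburg φ μ k ⟨s, hs⟩) (u N) (u n - u N)
      rw [add_sub_cancel] at h1
      have h2 := hu N N n le_rfl hn
      have h3 : luxemburg φ μ k ⟨s, hs⟩ (u n - u N) ≤ luxemburg φ μ k
        ⟨(N : ℝ) + 1, by simp only [mem_Ioi]; positivity⟩ (u n - u N) :=
        luxemburg_mono φ μ (show s ≤ N + 1 by linarith) _
      have h4 : (1 / 2 : ℝ) ^ N ≤ 1 := pow_le_one₀ (by norm_num) (by norm_num)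
      linarith
  refine ⟨(⟨v, hvmem⟩ : ASSubmodule φ μ k),
    ((withSeminorms_luxemburg φ μ k).tendsto_nhds_atTop _ _).2 fun s ε hε => ?_⟩
  obtain ⟨N₁, hN₁⟩ := exists_nat_ge (s : ℝ)
  obtain ⟨N₂, hN₂⟩ := exists_pow_lt_of_lt_one hε (by norm_num : (1 / 2 : ℝ) < 1)
  set N := max N₁ N₂ with hN
  have hNε : (1 / 2 : ℝ) ^ N < ε :=
    (pow_le_pow_of_le_one (by norm_num) (by norm_num) (le_max_right _ _)).trans_lt hN₂
  have hNs : (s : ℝ) ≤ N + 1 := by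
    have : (N₁ : ℝ) ≤ N := Nat.cast_le.2 (le_max_left _ _)
    linarith
  refine ⟨N, fun n hn => lt_of_le_of_lt ?_ hNε⟩
  refine luxemburg_le φ μ (by positivity) ?_
  change modular φ μ s (((1 / 2 : ℝ) ^ N)⁻¹ • (AS.toCochain φ μ k (u n) - v)) ≤ 1
  -- With `n` fixed and `m → ∞`, the Cauchy bound passes to the limit.
  refine modular_le_of_tendsto φ μ (w := fun m => ((1 / 2 : ℝ) ^ N)⁻¹ •
    (AS.toCochain φ μ k (u n) - AS.toCochain φ μ k (u m))) ?_ ?_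
  · filter_upwards [hlim, AEEqFun.coeFn_smul ((1 / 2 : ℝ) ^ N)⁻¹ (AS.toCochain φ μ k (u n) - v),
      AEEqFun.coeFn_sub (AS.toCochain φ μ k (u n)) v,
      ae_all_iff.2 fun m => AEEqFun.coeFn_smul ((1 / 2 : ℝ) ^ N)⁻¹
        (AS.toCochain φ μ k (u n) - AS.toCochain φ μ k (u m)),
      ae_all_iff.2 fun m => AEEqFun.coeFn_sub (AS.toCochain φ μ k (u n))
        (AS.toCochain φ μ k (u m))] with Δ h1 h2 h3 h4 h5
    simp only [h2, h3, h4, h5, Pi.smul_apply, Pi.sub_apply]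
    exact (tendsto_const_nhds.sub h1).const_smul _
  · filter_upwards [Filter.eventually_ge_atTop N] with m hm
    exact hmod s N hNs m n hm hn

/-- The uniformity is countably generated, so it suffices to treat sequences that are Cauchy at a
prescribed speed: scale `N + 1` with tolerance `2⁻ᴺ`. -/
theorem completeSpace_AS (k : ℕ) :
    @CompleteSpace (AS φ μ k) (IsTopologicalAddGroup.rightUniformSpace (AS φ μ k)) := by
  let : UniformSpace (AS φ μ k) := IsTopologicalAddGroup.rightUniformSpace (AS φ μ k)
  have : IsUniformAddGroup (AS φ μ k) := isUniformAddGroup_of_addCommGroup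
  have : (uniformity (AS φ μ k)).IsCountablyGenerated :=
    IsUniformAddGroup.uniformity_countably_generated
  refine UniformSpace.complete_of_convergent_controlled_sequences (fun N => {p |
    luxemburg φ μ k ⟨(N : ℝ) + 1, by simp only [mem_Ioi]; positivity⟩ (p.2 - p.1) <
      (1 / 2 : ℝ) ^ N}) (fun N => ?_) fun u hu => ?_
  · rw [uniformity_eq_comap_nhds_zero]
    refine ⟨{x | luxemburg φ μ k ⟨(N : ℝ) + 1, by simp only [mem_Ioi]; positivity⟩ x <
      (1 / 2 : ℝ) ^ N}, ?_, fun _ h => h⟩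
    have hc := (withSeminorms_luxemburg φ μ k).continuous_seminorm
      ⟨(N : ℝ) + 1, by simp only [mem_Ioi]; positivity⟩
    refine (isOpen_lt hc continuous_const).mem_nhds ?_
    simp only [mem_ofPred_eq, map_zero]
    positivity
  · exact exists_tendsto_of_luxemburg_lt φ μ u fun N m n hm hn => hu N m n hm hn

end Frechet

/-! ### Quotients of Fréchet spaces and the reduced cohomology. -/

section Quotients

theorem LocallyConvexSpace.quotient {E : Type*} [AddCommGroup E] [Module ℝ E] [TopologicalSpace E]
    [IsTopologicalAddGroup E] [ContinuousSMul ℝ E] [LocallyConvexSpace ℝ E] (S : Submodule ℝ E) :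
    LocallyConvexSpace ℝ (E ⧸ S) := by
  rw [locallyConvexSpace_iff_exists_convex_subset_zero]
  intro U hU
  have h1 : S.mkQ ⁻¹' U ∈ 𝓝 (0 : E) := by
    refine S.isOpenQuotientMap_mkQ.continuous.continuousAt.preimage_mem_nhds ?_
    rwa [map_zero]
  obtain ⟨V, hV, hc, hVU⟩ := (locallyConvexSpace_iff_exists_convex_subset_zero ℝ E).1 ‹_› _ h1
  refine ⟨S.mkQ '' V, ?_, hc.linear_image _, image_subset_iff.2 hVU⟩
  have := S.isOpenQuotientMap_mkQ.isOpenMap.image_mem_nhds hV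
  rwa [map_zero] at this

theorem isFrechetSpace_quotient {E : Type*} [AddCommGroup E] [Module ℝ E] [TopologicalSpace E]
    [IsTopologicalAddGroup E] [ContinuousSMul ℝ E] [LocallyConvexSpace ℝ E]
    [FirstCountableTopology E]
    (hE : @CompleteSpace E (IsTopologicalAddGroup.rightUniformSpace E)) (S : Submodule ℝ E)
    (hS : IsClosed (S : Set E)) : IsFrechetSpace (E ⧸ S) where
  isTopologicalAddGroup := inferInstance
  continuousSMul := inferInstance
  locallyConvex := LocallyConvexSpace.quotient S
  t2 := by
    have := hS
    infer_instance
  firstCountable := QuotientAddGroup.instFirstCountableTopology S.toAddSubgroup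
  complete := by
    let := IsTopologicalAddGroup.rightUniformSpace E
    exact QuotientAddGroup.completeSpace_right' E S.toAddSubgroup

/-- A commutative topological group has only one compatible group uniformity, so the one of `Z` is
the subspace uniformity. -/
theorem completeSpace_rightUniformSpace_of_isClosed {E : Type*} [AddCommGroup E] [Module ℝ E]
    [TopologicalSpace E] [IsTopologicalAddGroup E]
    (hE : @CompleteSpace E (IsTopologicalAddGroup.rightUniformSpace E)) (Z : Submodule ℝ E)
    (hZ : IsClosed (Z : Set E)) :
    @CompleteSpace Z (IsTopologicalAddGroup.rightUniformSpace Z) := by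
  let : UniformSpace E := IsTopologicalAddGroup.rightUniformSpace E
  have : IsUniformAddGroup E := isUniformAddGroup_of_addCommGroup
  have h : CompleteSpace Z := hZ.completeSpace_coe
  have : IsUniformAddGroup Z := Z.toAddSubgroup.isUniformAddGroup
  have e : IsTopologicalAddGroup.rightUniformSpace Z = instUniformSpaceSubtype :=
    IsUniformAddGroup.rightUniformSpace_eq
  rw [e]
  exact h

variable {X : Type*} [MetricSpace X] [MeasurableSpace X] [BorelSpace X] (φ : YoungFunction)
  (μ : Measure X) [BoundedGeometry μ]

theorem isFrechetSpace_reducedOrliczCohomology (k : ℕ) :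
    IsFrechetSpace (ReducedOrliczCohomology φ μ k) := by
  have hZ : IsClosed (cocycles φ μ k : Set (AS φ μ k)) :=
    isClosed_singleton.preimage (continuous_coboundary φ μ k)
  have : FirstCountableTopology (cocycles φ μ k) :=
    Topology.IsInducing.subtypeVal.firstCountableTopology
  refine isFrechetSpace_quotient
    (completeSpace_rightUniformSpace_of_isClosed (completeSpace_AS φ μ k) _ hZ) _ ?_
  exact (Submodule.isClosed_topologicalClosure _).preimage continuous_subtype_val

end Quotients

/-! ### Kernels along coarse maps -/

section CoarseKernels

open ProbabilityTheory

/-- `F` maps points at bounded distance to points at bounded distance. -/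
def Bornologous {X Y : Type*} [MetricSpace X] [MetricSpace Y] (F : X → Y) : Prop :=
  ∀ r : ℝ, ∃ t : ℝ, ∀ x x' : X, dist x x' ≤ r → dist (F x) (F x') ≤ t

/-- Points whose images under `F` are at bounded distance are at bounded distance. -/
def EffectivelyProper {X Y : Type*} [MetricSpace X] [MetricSpace Y] (F : X → Y) : Prop :=
  ∀ r : ℝ, ∃ t : ℝ, ∀ x x' : X, dist (F x) (F x') ≤ r → dist x x' ≤ t

theorem bornologous_id {X : Type*} [MetricSpace X] : Bornologous (id : X → X) :=
  fun r => ⟨r, fun _ _ h => h⟩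

theorem IsQuasiIsometry.bornologous {X Y : Type*} [MetricSpace X] [MetricSpace Y] {F : X → Y}
    (hF : IsQuasiIsometry F) : Bornologous F := by
  obtain ⟨L, ε, hL, -, h, -⟩ := hF
  refine fun r => ⟨L * r + ε, fun x x' hx => ((h x x').2).trans ?_⟩
  gcongr

theorem IsQuasiIsometry.effectivelyProper {X Y : Type*} [MetricSpace X] [MetricSpace Y] {F : X → Y}
    (hF : IsQuasiIsometry F) : EffectivelyProper F := by
  obtain ⟨L, ε, hL, -, h, -⟩ := hF
  refine fun r => ⟨L * (r + ε), fun x x' hx => ?_⟩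
  have := (h x x').1
  rw [← inv_mul_le_iff₀ (by linarith)]
  linarith

/-- A quasi-isometry has a coarse inverse. -/
theorem IsQuasiIsometry.exists_coarse_inverse {X Y : Type*} [MetricSpace X] [MetricSpace Y]
    {F : X → Y} (hF : IsQuasiIsometry F) : ∃ G : Y → X, Bornologous G ∧ EffectivelyProper G ∧
      (∃ D : ℝ, ∀ x, dist (G (F x)) x ≤ D) ∧ ∃ D : ℝ, ∀ y, dist (F (G y)) y ≤ D := by
  have hb := hF.bornologous
  have hp := hF.effectivelyProper
  obtain ⟨L, ε, hL, hε, h, hsurj⟩ := hF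
  choose G hG using hsurj
  -- `G y` is a point that `F` sends within `ε` of `y`. Effective properness of `F` makes `G`
  -- bornologous, and bornology of `F` makes `G` effectively proper.
  refine ⟨G, fun r => ?_, fun r => ?_, ?_, ε, hG⟩
  · obtain ⟨t, ht⟩ := hp (ε + r + ε)
    refine ⟨t, fun y y' hy => ht _ _ ?_⟩
    have h1 := dist_triangle4 (F (G y)) y y' (F (G y'))
    have h2 := hG y
    have h3 := hG y'
    rw [dist_comm] at h3
    linarith
  · obtain ⟨t, ht⟩ := hb r
    refine ⟨ε + t + ε, fun y y' hy => ?_⟩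
    have h1 := dist_triangle4 y (F (G y)) (F (G y')) y'
    have h2 := hG y
    rw [dist_comm] at h2
    linarith [hG y', ht _ _ hy]
  · obtain ⟨t, ht⟩ := hp ε
    exact ⟨t, fun x => ht _ _ (hG (F x))⟩

variable {X Y : Type*} [MetricSpace X] [MeasurableSpace X] [MetricSpace Y] [MeasurableSpace Y]

/-- The kernel `κ` has bounded density, also on average, and is supported near the graph of `F`. -/
structure IsCoarseKernel (μ : Measure X) (ν : Measure Y) (κ : Kernel X Y) (F : X → Y) : Prop where
  support : ∃ R : ℝ, ∀ x, ∀ᵐ y ∂κ x, dist y (F x) ≤ R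
  bound : ∃ C : ℝ≥0∞, 1 ≤ C ∧ C ≠ ∞ ∧ (∀ x, κ x ≤ C • ν) ∧ κ ∘ₘ μ ≤ C • ν

/-- Sending `x` to the first net point near it discretises `X` measurably, so a non-measurable `F`
need only be evaluated on a countable set. -/
theorem exists_measurable_index [BorelSpace X] [Nonempty X] (μ : Measure X) [BoundedGeometry μ] :
    ∃ (e : ℕ → X) (p : X → ℕ) (R : ℝ), Measurable p ∧ ∀ x, dist x (e (p x)) < R := by
  classical
  obtain ⟨N, R, hNc, hN⟩ := exists_countable_net μ
  have hne : N.Nonempty := by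
    obtain ⟨n, hn, -⟩ := hN (Classical.arbitrary X)
    exact ⟨n, hn⟩
  obtain ⟨e, rfl⟩ := hNc.exists_eq_range hne
  have hp : ∀ x, ∃ n, dist x (e n) < R := fun x => by
    obtain ⟨_, ⟨n, rfl⟩, h⟩ := hN x
    exact ⟨n, h⟩
  exact ⟨e, fun x => Nat.find (hp x), R,
    measurable_find hp fun n => (Metric.isOpen_ball (x := e n) (ε := R)).measurableSet,
    fun x => Nat.find_spec (hp x)⟩

/-- Let `κ x` be `ν` normalised on the `r`-ball about `F (e (p x))`. The lower volume bound `c`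
makes its density at most `c⁻¹`. The averaged density at `y` is at most `c⁻¹` times the measure of
those `x` whose ball contains `y`, and effective properness confines these to one ball of `X`. -/
theorem exists_isCoarseKernel [BorelSpace X] [BorelSpace Y] (μ : Measure X) (ν : Measure Y)
    [BoundedGeometry μ] [BoundedGeometry ν] {F : X → Y} (hF : Bornologous F)
    (hF' : EffectivelyProper F) :
    ∃ κ : Kernel X Y, IsMarkovKernel κ ∧ IsCoarseKernel μ ν κ F := by
  rcases isEmpty_or_nonempty X with hX | hX
  · refine ⟨0, ⟨fun x => hX.elim x⟩, ⟨0, fun x => hX.elim x⟩, 1, le_rfl, ENNReal.one_ne_top,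
      fun x => hX.elim x, ?_⟩
    rw [Measure.eq_zero_of_isEmpty μ, Measure.bind_zero_left]
    exact Measure.zero_le _
  obtain ⟨e, p, R, hp, hR⟩ := exists_measurable_index μ
  obtain ⟨r, hr, h⟩ := BoundedGeometry.exists_radius (μ := ν)
  obtain ⟨r₀, hr₀, h₀⟩ := BoundedGeometry.exists_radius (μ := μ)
  set c : ℝ≥0∞ := ⨅ y, ν (Metric.ball y r) with hc
  have hc0 : c ≠ 0 := (h r le_rfl).1.ne'
  have hcle : ∀ y, c ≤ ν (Metric.ball y r) := fun y => iInf_le _ y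
  have hball0 : ∀ y, ν (Metric.ball y r) ≠ 0 := fun y =>
    (lt_of_lt_of_le (h r le_rfl).1 (hcle y)).ne'
  have hballt : ∀ y, ν (Metric.ball y r) ≠ ∞ := fun y => (measure_ball_lt_top ν y r).ne
  set κ : Kernel X Y := (Kernel.ofFunOfCountable fun n : ℕ =>
    ProbabilityTheory.cond ν (Metric.ball (F (e n)) r)).comap p hp with hκ
  have hκx : ∀ x, κ x = ProbabilityTheory.cond ν (Metric.ball (F (e (p x))) r) := fun x => rfl
  have hκB : ∀ x B, κ x B ≤ c⁻¹ * ν (Metric.ball (F (e (p x))) r ∩ B) := fun x B => by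
    rw [hκx, cond_apply Metric.isOpen_ball.measurableSet]
    gcongr
    exact hcle _
  obtain ⟨t, ht⟩ := hF' (2 * r)
  obtain ⟨R', hR'⟩ := hF R
  -- If the balls of `x` and `x₁` share a point, their centres are less than `2 * r` apart, the net
  -- points at most `t` apart, and `x`, `x₁` less than `t + 2 * R` apart.
  set ρ := max r₀ (t + 2 * R) with hρ
  set V : ℝ≥0∞ := ⨆ x, μ (Metric.ball x ρ) with hV
  have hVt : V < ∞ := (h₀ ρ (le_max_left _ _)).2
  -- In the constant, `1` ensures `1 ≤ C`, `c⁻¹` serves the pointwise bound and `c⁻¹ * V` the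
  -- averaged one.
  refine ⟨κ, ⟨fun x => ?_⟩, ⟨r + R', fun x => ?_⟩, 1 + c⁻¹ + c⁻¹ * V, ?_, ?_, fun x => ?_, ?_⟩
  · rw [hκx]
    exact cond_isProbabilityMeasure_of_finite (hball0 _) (hballt _)
  · have hb : ∀ᵐ y ∂κ x, y ∈ Metric.ball (F (e (p x))) r := by
      rw [hκx]
      exact ae_cond_mem Metric.isOpen_ball.measurableSet
    filter_upwards [hb] with y hy
    have h1 := hR' x (e (p x)) (hR x).le
    rw [Metric.mem_ball] at hy
    rw [dist_comm] at h1
    linarith [dist_triangle y (F (e (p x))) (F x)]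
  · rw [add_assoc]; exact le_self_add
  · have := ENNReal.inv_ne_top.2 hc0
    exact ENNReal.add_ne_top.2 ⟨ENNReal.add_ne_top.2 ⟨ENNReal.one_ne_top, this⟩,
      ENNReal.mul_ne_top this hVt.ne⟩
  · refine Measure.le_iff.2 fun B _ => (hκB x B).trans ?_
    rw [Measure.smul_apply, smul_eq_mul]
    gcongr
    · exact le_add_right le_add_self
    · exact inter_subset_right
  · refine Measure.le_iff.2 fun B hB => ?_
    -- The incidence relation as a countable union of rectangles, hence measurable and open to
    -- Tonelli.
    set D : Set (X × Y) := ⋃ n : ℕ, (p ⁻¹' {n}) ×ˢ Metric.ball (F (e n)) r with hD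
    have hDm : MeasurableSet D := MeasurableSet.iUnion fun n =>
      (hp (measurableSet_singleton n)).prod Metric.isOpen_ball.measurableSet
    have hmemD : ∀ x y, (x, y) ∈ D ↔ y ∈ Metric.ball (F (e (p x))) r := fun x y => by
      simp [hD]
    have hDB : MeasurableSet (D ∩ univ ×ˢ B) := hDm.inter (MeasurableSet.univ.prod hB)
    have hslice : ∀ y, μ ((fun x => (x, y)) ⁻¹' (D ∩ univ ×ˢ B)) ≤ B.indicator (fun _ => V) y := by
      intro y
      by_cases hy : y ∈ B
      · rw [indicator_of_mem hy]
        rcases eq_empty_or_nonempty ((fun x => (x, y)) ⁻¹' (D ∩ univ ×ˢ B)) with h0 | ⟨x₁, h₁⟩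
        · rw [h0, measure_empty]; exact zero_le
        · refine (measure_mono fun x hx => ?_).trans (le_iSup (fun x => μ (Metric.ball x ρ)) x₁)
          have a1 := (hmemD x y).1 hx.1
          have a2 := (hmemD x₁ y).1 h₁.1
          rw [Metric.mem_ball] at a1 a2 ⊢
          have a3 := ht (e (p x)) (e (p x₁)) (by
            linarith [dist_triangle_left (F (e (p x))) (F (e (p x₁))) y])
          have a4 := dist_triangle4 x (e (p x)) (e (p x₁)) x₁
          have a5 := hR x
          have a6 := hR x₁
          rw [dist_comm] at a6
          exact lt_of_lt_of_le (by linarith) (le_max_right _ _)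
      · rw [indicator_of_notMem hy, nonpos_iff_eq_zero]
        refine measure_mono_null (fun x hx => hy hx.2.2) measure_empty
    calc (κ ∘ₘ μ) B = ∫⁻ x, κ x B ∂μ := Measure.bind_apply hB (Kernel.aemeasurable _)
      _ ≤ ∫⁻ x, c⁻¹ * ν (Prod.mk x ⁻¹' (D ∩ univ ×ˢ B)) ∂μ := by
          refine lintegral_mono fun x => (hκB x B).trans ?_
          gcongr
          exact fun y hy => ⟨(hmemD x y).2 hy.1, mem_univ _, hy.2⟩
      _ = c⁻¹ * ∫⁻ y, μ ((fun x => (x, y)) ⁻¹' (D ∩ univ ×ˢ B)) ∂ν := by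
          rw [lintegral_const_mul _ (measurable_measure_prodMk_left hDB),
            ← Measure.prod_apply hDB, Measure.prod_apply_symm hDB]
      _ ≤ c⁻¹ * ∫⁻ y, B.indicator (fun _ => V) y ∂ν := by
          gcongr with y
          exact hslice y
      _ = c⁻¹ * V * ν B := by rw [lintegral_indicator_const hB, mul_assoc]
      _ ≤ _ := by
          rw [Measure.smul_apply, smul_eq_mul]
          gcongr
          exact le_add_self

variable {μ : Measure X} {ν : Measure Y} {κ : Kernel X Y} {F : X → Y}

/-- The support is found by going from `z` to `G y`, to `G (F x)`, to `x`. The pointwise bound comes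
from `η` alone, averaged over the probability `κ x`; the averaged bounds multiply. -/
theorem IsCoarseKernel.comp [BorelSpace X] [IsMarkovKernel κ] {η : Kernel Y X} {G : Y → X}
    (hκ : IsCoarseKernel μ ν κ F) (hη : IsCoarseKernel ν μ η G) (hG : Bornologous G)
    (hGF : ∃ D : ℝ, ∀ x, dist (G (F x)) x ≤ D) : IsCoarseKernel μ μ (η ∘ₖ κ) id := by
  obtain ⟨R, hR⟩ := hκ.support
  obtain ⟨R', hR'⟩ := hη.support
  obtain ⟨C, hC1, hCt, hC, hCμ⟩ := hκ.bound
  obtain ⟨C', hC1', hCt', hC', hCν⟩ := hη.bound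
  obtain ⟨D, hD⟩ := hGF
  obtain ⟨t, ht⟩ := hG R
  refine ⟨⟨R' + t + D, fun x => ?_⟩, C * C', one_le_mul hC1 hC1', ENNReal.mul_ne_top hCt hCt',
    fun x => ?_, ?_⟩
  · refine Kernel.ae_comp_of_ae_ae
      (Metric.isClosed_closedBall (x := x) (ε := R' + t + D)).measurableSet ?_
    filter_upwards [hR x] with y hy
    filter_upwards [hR' y] with z hz
    have h1 := ht _ _ hy
    have h2 := dist_triangle4 z (G y) (G (F x)) x
    have h3 := hD x
    change dist z x ≤ _
    linarith
  · refine Measure.le_iff.2 fun B hB => ?_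
    rw [Kernel.comp_apply' _ _ _ hB]
    calc ∫⁻ y, η y B ∂κ x ≤ ∫⁻ _, C' * μ B ∂κ x := lintegral_mono fun y => hC' y B
      _ = C' * μ B := by rw [lintegral_const, measure_univ, mul_one]
      _ ≤ C * C' * μ B := by
          gcongr
          exact le_mul_of_one_le_left' hC1
  · refine Measure.le_iff.2 fun B hB => ?_
    rw [← Measure.comp_assoc, Measure.bind_apply hB (Kernel.aemeasurable _)]
    calc ∫⁻ y, η y B ∂(κ ∘ₘ μ) ≤ ∫⁻ y, η y B ∂(C • ν) := lintegral_mono' hCμ le_rfl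
      _ = C * (η ∘ₘ ν) B := by
          rw [lintegral_smul_measure, Measure.bind_apply hB (Kernel.aemeasurable _), smul_eq_mul]
      _ ≤ C * (C' * μ B) := by gcongr; exact hCν B
      _ = _ := by rw [Measure.smul_apply, smul_eq_mul, mul_assoc]

theorem ae_piKernel {A B : Type*} [MeasurableSpace A] [MeasurableSpace B] (κ : Kernel A B)
    [IsMarkovKernel κ] {n : ℕ} {x : Fin n → A} {q : Fin n → B → Prop}
    (h : ∀ i, ∀ᵐ y ∂κ (x i), q i y) : ∀ᵐ y ∂piKernel κ n x, ∀ i, q i (y i) := by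
  rw [piKernel_apply]
  exact ae_all_iff.2 fun i =>
    (Measure.quasiMeasurePreserving_eval (μ := fun i => κ (x i)) i).ae (h i)

variable [BorelSpace X] [BoundedGeometry μ]

/-- Random vertices lie within `R` of the `F (Δ i)`, so diameters grow by at most `2 * R` beyond the
distortion of `F`. -/
theorem IsCoarseKernel.controlled_piKernel [BorelSpace Y] [BoundedGeometry ν]
    [IsMarkovKernel κ] (hκ : IsCoarseKernel μ ν κ F) (hF : Bornologous F) (k : ℕ) :
    ControlledKernel μ ν (piKernel κ (k + 1)) := by
  obtain ⟨R, hR⟩ := hκ.support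
  obtain ⟨C, hC1, hCt, -, hC⟩ := hκ.bound
  refine ControlledKernel.of_comp_le (ENNReal.pow_ne_top hCt)
    (piKernel_comp_le κ μ ν (one_pos.trans_le hC1).ne' hCt hC (k + 1)) fun s => ?_
  obtain ⟨t, ht⟩ := hF s
  refine ⟨max 0 (R + t + R), fun Δ hΔ => ?_⟩
  filter_upwards [ae_piKernel κ fun i => hR (Δ i)] with Δ' h
  refine mem_smallSimplices_of_dist_le (le_max_left _ _) fun i j => le_max_of_le_right ?_
  have h1 := dist_triangle4 (Δ' i) (F (Δ i)) (F (Δ j)) (Δ' j)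
  have h2 := h i
  have h3 := h j
  rw [dist_comm] at h3
  linarith [ht _ _ (dist_le_of_mem_smallSimplices hΔ i j)]

theorem IsCoarseKernel.controlled_prismKernel {κ : Kernel X X} [IsMarkovKernel κ]
    (hκ : IsCoarseKernel μ μ κ id) {k : ℕ} (i : Fin (k + 1)) :
    ControlledKernel μ μ (prismKernel κ i) := by
  obtain ⟨R, hR⟩ := hκ.support
  obtain ⟨C, hC1, hCt, hC, hC'⟩ := hκ.bound
  refine ControlledKernel.of_comp_le (ENNReal.pow_ne_top hCt)
    (prismKernel_comp_le κ μ hC1 hCt hC' hC i) fun s => ?_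
  -- Smallness is pulled back along `prism`, which calls for a measurable set. Each prism vertex is
  -- within `max 0 R` of its base vertex, whence `2 * max 0 R`.
  obtain ⟨W, t, -, hW, hsW, hWt⟩ := exists_measurableSet_smallSimplices μ (k + 1)
    (2 * max 0 R + max 0 s)
  refine ⟨t, fun Δ hΔ => ?_⟩
  have hball : ∀ x : X, MeasurableSet {z | dist z x ≤ max 0 R} := fun x =>
    (Metric.isClosed_closedBall (x := x) (ε := max 0 R)).measurableSet
  have hz : ∀ j, ∀ᵐ z ∂graphKernel κ (Δ j),
      dist z.1 (Δ j) ≤ max 0 R ∧ dist z.2 (Δ j) ≤ max 0 R := by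
    intro j
    have h1 : ∀ᵐ x ∂(graphKernel κ (Δ j)).map Prod.fst, dist x (Δ j) ≤ max 0 R := by
      rw [graphKernel_map_fst, ae_dirac_iff (hball _), dist_self]
      exact le_max_left _ _
    have h2 : ∀ᵐ x ∂(graphKernel κ (Δ j)).map Prod.snd, dist x (Δ j) ≤ max 0 R := by
      rw [graphKernel_map_snd]
      filter_upwards [hR (Δ j)] with x hx using le_max_of_le_right hx
    exact (ae_of_ae_map measurable_fst.aemeasurable h1).and
      (ae_of_ae_map measurable_snd.aemeasurable h2)
  have hmem : ∀ᵐ Δ' ∂prismKernel κ i Δ, Δ' ∈ W := by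
    rw [prismKernel, Kernel.map_apply _ (measurable_prism i)]
    refine (ae_map_iff (p := fun Δ' => Δ' ∈ W) (measurable_prism i).aemeasurable hW).2 ?_
    filter_upwards [ae_piKernel _ hz] with z hz
    refine hsW (mem_smallSimplices_of_dist_le (by positivity) fun l l' => ?_)
    have hl : ∀ l, dist (prism i z l) (Δ (i.predAbove l)) ≤ max 0 R := fun l => by
      unfold prism
      split_ifs
      exacts [(hz _).1, (hz _).2]
    have h1 := hl l
    have h2 := hl l'
    rw [dist_comm] at h2
    have h3 := dist_triangle4 (prism i z l) (Δ (i.predAbove l)) (Δ (i.predAbove l')) (prism i z l')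
    have h4 := dist_le_of_mem_smallSimplices hΔ (i.predAbove l) (i.predAbove l')
    linarith [le_max_right 0 s]
  filter_upwards [hmem] with Δ' h using hWt h

end CoarseKernels

/-! ### Quasi-isometry invariance -/

section Invariance

open ProbabilityTheory

/-- Continuous linear maps that are mutually inverse modulo given subspaces induce an isomorphism
of topological vector spaces between the quotients. -/
theorem nonempty_quotient_equiv {E E' : Type*} [AddCommGroup E] [Module ℝ E] [TopologicalSpace E]
    [IsTopologicalAddGroup E] [AddCommGroup E'] [Module ℝ E'] [TopologicalSpace E']
    [IsTopologicalAddGroup E'] {Z B : Submodule ℝ E} {Z' B' : Submodule ℝ E'}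
    (T : E →L[ℝ] E') (S : E' →L[ℝ] E) (hTZ : ∀ u ∈ Z, T u ∈ Z') (hSZ : ∀ u ∈ Z', S u ∈ Z)
    (hTB : ∀ u ∈ B, T u ∈ B') (hSB : ∀ u ∈ B', S u ∈ B)
    (hST : ∀ u ∈ Z, S (T u) - u ∈ B) (hTS : ∀ u ∈ Z', T (S u) - u ∈ B') :
    Nonempty ((Z ⧸ B.submoduleOf Z) ≃L[ℝ] (Z' ⧸ B'.submoduleOf Z')) := by
  let f : Z →ₗ[ℝ] Z' := (T : E →ₗ[ℝ] E').restrict hTZ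
  let g : Z' →ₗ[ℝ] Z := (S : E' →ₗ[ℝ] E).restrict hSZ
  have hf : B.submoduleOf Z ≤ (B'.submoduleOf Z').comap f := fun u hu => hTB u hu
  have hg : B'.submoduleOf Z' ≤ (B.submoduleOf Z).comap g := fun u hu => hSB u hu
  have hfc : Continuous f := (T.continuous.comp continuous_subtype_val).subtype_mk _
  have hgc : Continuous g := (S.continuous.comp continuous_subtype_val).subtype_mk _
  refine ⟨⟨LinearEquiv.ofLinearMap (Submodule.mapQ _ _ f hf) (Submodule.mapQ _ _ g hg) ?_ ?_,
    ?_, ?_⟩⟩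
  · ext u
    change Submodule.Quotient.mk (f (g u)) = Submodule.Quotient.mk u
    exact (Submodule.Quotient.eq _).2 (hTS u u.2)
  · ext u
    change Submodule.Quotient.mk (g (f u)) = Submodule.Quotient.mk u
    exact (Submodule.Quotient.eq _).2 (hST u u.2)
  · exact ((B.submoduleOf Z).isQuotientMap_mkQ.continuous_iff).2
      ((B'.submoduleOf Z').isQuotientMap_mkQ.continuous.comp hfc)
  · exact ((B'.submoduleOf Z').isQuotientMap_mkQ.continuous_iff).2
      ((B.submoduleOf Z).isQuotientMap_mkQ.continuous.comp hgc)

variable {X Y : Type*} [MetricSpace X] [MeasurableSpace X] [BorelSpace X]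
  [MetricSpace Y] [MeasurableSpace Y] [BorelSpace Y] (φ : YoungFunction)
  {μ : Measure X} {ν : Measure Y} [BoundedGeometry μ] [BoundedGeometry ν]

/-- Fubini for composed kernels, legitimate for almost every `Δ` by integrability against the
composite. -/
theorem kernelOp_piKernel_comp {κ : Kernel X Y} {η : Kernel Y X} [IsMarkovKernel κ]
    [IsMarkovKernel η] {n : ℕ} (hκ : ControlledKernel μ ν (piKernel κ (n + 1)))
    (hη : ControlledKernel ν μ (piKernel η (n + 1)))
    (hηκ : ControlledKernel μ μ (piKernel (η ∘ₖ κ) (n + 1))) (u : AS φ μ n) :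
    kernelOp φ _ hκ (kernelOp φ _ hη u) = kernelOp φ _ hηκ u := by
  refine Subtype.ext (AEEqFun.ext ?_)
  filter_upwards [coeFn_kernelOp φ _ hκ (kernelOp φ _ hη u), coeFn_kernelOp φ _ hηκ u,
    hκ.ae_ae (coeFn_kernelOp φ _ hη u), hηκ.ae_integrable φ u.2] with Δ h1 h2 h3 h4
  refine h1.trans (Eq.trans ?_ h2.symm)
  rw [integral_congr_ae h3]
  rw [← piKernel_comp] at h4 ⊢
  exact (Kernel.integral_comp h4).symm

theorem kernelOp_piKernel_mem_coboundaries (κ : Kernel X Y) [IsMarkovKernel κ]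
    (hκ : ∀ k : ℕ, ControlledKernel μ ν (piKernel κ (k + 1))) {k : ℕ} {u : AS φ ν k}
    (hu : u ∈ coboundaries φ ν k) : kernelOp φ _ (hκ k) u ∈ coboundaries φ μ k := by
  cases k with
  | zero =>
    rw [show u = 0 from hu, map_zero]
    exact Submodule.zero_mem _
  | succ k =>
    obtain ⟨v, rfl⟩ := hu
    exact ⟨kernelOp φ _ (hκ k) v, coboundary_kernelOp_piKernel φ μ ν κ hκ k v⟩

theorem kernelOp_piKernel_mem_cocycles (κ : Kernel X Y) [IsMarkovKernel κ]
    (hκ : ∀ k : ℕ, ControlledKernel μ ν (piKernel κ (k + 1))) {k : ℕ} {u : AS φ ν k}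
    (hu : u ∈ cocycles φ ν k) : kernelOp φ _ (hκ k) u ∈ cocycles φ μ k := by
  have hu : coboundary φ ν k u = 0 := hu
  change coboundary φ μ k _ = 0
  rw [coboundary_kernelOp_piKernel φ μ ν κ hκ, hu, map_zero]

/-- Going back and forth between `X` and `Y` is the identity on cohomology. -/
theorem kernelOp_kernelOp_sub_mem_coboundaries {κ : Kernel X Y} {η : Kernel Y X}
    [IsMarkovKernel κ] [IsMarkovKernel η] {F : X → Y} {G : Y → X}
    (hκ : IsCoarseKernel μ ν κ F) (hη : IsCoarseKernel ν μ η G) (hF : Bornologous F)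
    (hG : Bornologous G) (hGF : ∃ D : ℝ, ∀ x, dist (G (F x)) x ≤ D) {k : ℕ} {u : AS φ μ k}
    (hu : u ∈ cocycles φ μ k) :
    kernelOp φ _ (hκ.controlled_piKernel hF k) (kernelOp φ _ (hη.controlled_piKernel hG k) u) - u ∈
      coboundaries φ μ k := by
  have h := hκ.comp hη hG hGF
  rw [kernelOp_piKernel_comp φ _ _ (h.controlled_piKernel bornologous_id k)]
  exact kernelOp_piKernel_sub_mem_coboundaries φ (η ∘ₖ κ)
    (h.controlled_piKernel bornologous_id) (fun _ i => h.controlled_prismKernel i) hu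

end Invariance

end

theorem theorem1p1 {X Y : Type*} [MetricSpace X] [MeasurableSpace X] [BorelSpace X]
    [MetricSpace Y] [MeasurableSpace Y] [BorelSpace Y]
    (μ : MeasureTheory.Measure X) (ν : MeasureTheory.Measure Y)
    [BoundedGeometry μ] [BoundedGeometry ν] (φ : YoungFunction)
    (F : X → Y) (hF : IsQuasiIsometry F) (k : ℕ) :
    Nonempty (OrliczCohomology φ μ k ≃L[ℝ] OrliczCohomology φ ν k) ∧
    IsFrechetSpace (ReducedOrliczCohomology φ μ k) ∧
    IsFrechetSpace (ReducedOrliczCohomology φ ν k) ∧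
    Nonempty (ReducedOrliczCohomology φ μ k ≃L[ℝ] ReducedOrliczCohomology φ ν k) := by
  obtain ⟨G, hG, hG', hGF, hFG⟩ := hF.exists_coarse_inverse
  obtain ⟨κ, _, hκ⟩ := exists_isCoarseKernel μ ν hF.bornologous hF.effectivelyProper
  obtain ⟨η, _, hη⟩ := exists_isCoarseKernel ν μ hG hG'
  -- Pullback is contravariant: `κ`, from `X` to `Y`, gives a map from cochains of `Y` to cochains
  -- of `X`.
  let S : AS φ ν k →L[ℝ] AS φ μ k :=
    ⟨kernelOp φ _ (hκ.controlled_piKernel hF.bornologous k), continuous_kernelOp φ _ _⟩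
  let T : AS φ μ k →L[ℝ] AS φ ν k :=
    ⟨kernelOp φ _ (hη.controlled_piKernel hG k), continuous_kernelOp φ _ _⟩
  have hTZ : ∀ u ∈ cocycles φ μ k, T u ∈ cocycles φ ν k := fun u hu =>
    kernelOp_piKernel_mem_cocycles φ η (hη.controlled_piKernel hG) hu
  have hSZ : ∀ u ∈ cocycles φ ν k, S u ∈ cocycles φ μ k := fun u hu =>
    kernelOp_piKernel_mem_cocycles φ κ (hκ.controlled_piKernel hF.bornologous) hu
  have hTB : ∀ u ∈ coboundaries φ μ k, T u ∈ coboundaries φ ν k := fun u hu =>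
    kernelOp_piKernel_mem_coboundaries φ η (hη.controlled_piKernel hG) hu
  have hSB : ∀ u ∈ coboundaries φ ν k, S u ∈ coboundaries φ μ k := fun u hu =>
    kernelOp_piKernel_mem_coboundaries φ κ (hκ.controlled_piKernel hF.bornologous) hu
  have hST : ∀ u ∈ cocycles φ μ k, S (T u) - u ∈ coboundaries φ μ k := fun u hu =>
    kernelOp_kernelOp_sub_mem_coboundaries φ hκ hη hF.bornologous hG hGF hu
  have hTS : ∀ u ∈ cocycles φ ν k, T (S u) - u ∈ coboundaries φ ν k := fun u hu =>
    kernelOp_kernelOp_sub_mem_coboundaries φ hη hκ hG hF.bornologous hFG hu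
  refine ⟨nonempty_quotient_equiv T S hTZ hSZ hTB hSB hST hTS,
    isFrechetSpace_reducedOrliczCohomology φ μ k, isFrechetSpace_reducedOrliczCohomology φ ν k,
    -- In the reduced case continuity carries closures into closures, and the homotopies land in the
    -- coboundaries, hence in their closure.
    nonempty_quotient_equiv T S hTZ hSZ (fun u hu => map_mem_closure T.continuous hu hTB)
      (fun u hu => map_mem_closure S.continuous hu hSB)
      (fun u hu => Submodule.le_topologicalClosure _ (hST u hu))
      (fun u hu => Submodule.le_topologicalClosure _ (hTS u hu))⟩
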